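/- Let ${\bf A}=({\bf A}_{ij})_{i,j\ge 0}$ be the infinite real matrix with entries \[ {\bf A}_{0,0}=\tfrac12,\quad {\bf A}_{0,1}=-1,\quad {\bf A}_{0,j}=0\ (j\ge 2), \] \[ {\bf A}_{1,0}=\frac{\pi^2}{12}+\sum_{k\ge1}\frac{(-1)^k}{k^2 2^k}-\frac{\log 2}{2},\quad {\bf A}_{1,1}=\tfrac12+\log 2,\quad {\bf A}_{1,k+1}=\frac1k+\frac{(-1)^k}{2^{k+1}}-\frac1{k2^k}\ (k\ge1), \] \[ {\bf A}_{r+1,0}=\frac{(-1)^r}{r}\sum_{j\ge r}\frac1{j3^j},\quad {\bf A}_{r+1,1}=0,\quad {\bf A}_{r+1,k+1}=\binom kr\Big(\frac{(-1)^{k-r}}{2^{k+1}}-\frac1{k2^k}\Big)\quad (r,k\ge1), \] where $\binom kr=0$ for $k<r$, and let ${\bf A}_n$ be its $(n+1)\times(n+1)$ principal submatrix with indices $0,\dots,n$. For $\rho\ge1$ let $\ell^1_\rho$ be the space of real sequences $x=(x_i)_{i\ge0}$ with $\|x\|_{1,\rho}=\sum_i\rho^i|x_i|<\infty$. Vectors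 in $\mathbb R^{n+1}$ are regarded as sequences by padding with zeroes. Call an eigenvalue $\lambda$ of a real square matrix its maximum eigenvalue if $\lambda$ is real and every other complex eigenvalue $\mu$ of the matrix satisfies $|\mu|<\lambda$. Fix $c\in\{0,1\}$. For every $n\ge 7$ there is exactly one triple $(\lambda_n,{\bf v}_n,{\bf w}_n)$ such that $\lambda_n$ is the maximum eigenvalue of ${\bf A}_n$, and ${\bf v}_n,{\bf w}_n\in\mathbb R^{n+1}$ are corresponding right and left eigenvectors, ${\bf A}_n{\bf v}_n=\lambda_n{\bf v}_n$ and ${\bf w}_n{\bf A}_n=\lambda_n{\bf w}_n$, normalized by $({\bf v}_n)_c=({\bf w}_n)_c=1$. As $n\to\infty$, the sequence $(\lambda_n)$ converges; there is a sequence ${\bf v}$, belonging to $\ell^1_\rho$ for every $1\le\rho\le3$, such that ${\bf v}_n\to{\bf v}$ in $\ell^1_\rho$ for every $1\le\rho\le3$; and $({\bf w}_n)$ converges in $\ell^\infty$. -/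

import Mathlib

open Filter Topology
open scoped ENNReal

noncomputable section

/-- The infinite coefficient matrix `A`, rows and columns indexed from `0`. Row and column `0` belong
to the coefficient of `log t`, row and column `k + 1` to the coefficient of `(t - 1) ^ k`. In the
last line `(-1) ^ (k + r)` is the sign `(-1) ^ ((k + 1) - (r + 1))`; the binomial coefficient
vanishes for `k < r`. -/
def parkingMatrix : ℕ → ℕ → ℝ
  | 0, 0 => 1 / 2
  | 0, 1 => -1
  | 0, _ + 2 => 0
  | 1, 0 => Real.pi ^ 2 / 12 + (∑' k : ℕ, (-1 : ℝ) ^ (k + 1) / (((k : ℝ) + 1) ^ 2 * 2 ^ (k + 1)))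
      - Real.log 2 / 2
  | 1, 1 => 1 / 2 + Real.log 2
  | 1, k + 2 => 1 / ((k : ℝ) + 1) + (-1 : ℝ) ^ (k + 1) / 2 ^ (k + 2)
      - 1 / (((k : ℝ) + 1) * 2 ^ (k + 1))
  | r + 2, 0 => (-1 : ℝ) ^ (r + 1) / ((r : ℝ) + 1)
      * ∑' j : ℕ, 1 / (((r : ℝ) + 1 + j) * 3 ^ (r + 1 + j))
  | _ + 2, 1 => 0
  | r + 2, k + 2 => (Nat.choose (k + 1) (r + 1) : ℝ)
      * ((-1 : ℝ) ^ (k + r) / 2 ^ (k + 2) - 1 / (((k : ℝ) + 1) * 2 ^ (k + 1)))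

/-- The `(n + 1) × (n + 1)` principal submatrix `A_n`. -/
def parkingTrunc (n : ℕ) : Matrix (Fin (n + 1)) (Fin (n + 1)) ℝ :=
  Matrix.of fun i j => parkingMatrix i j

/-- `lam` is an eigenvalue of the real matrix `B`, and all other complex eigenvalues of `B` are
smaller than `lam` in absolute value. -/
def IsMaxEigenvalue {m : ℕ} (B : Matrix (Fin m) (Fin m) ℝ) (lam : ℝ) : Prop :=
  Module.End.HasEigenvalue (Matrix.toLin' (B.map (algebraMap ℝ ℂ))) (lam : ℂ) ∧
    ∀ μ : ℂ, Module.End.HasEigenvalue (Matrix.toLin' (B.map (algebraMap ℝ ℂ))) μ →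
      μ ≠ (lam : ℂ) → ‖μ‖ < lam

/-- A finite vector, padded by zeroes to a sequence. -/
def padZero {m : ℕ} (x : Fin m → ℝ) (i : ℕ) : ℝ :=
  if h : i < m then x ⟨i, h⟩ else 0

/-- `lam` is the maximum eigenvalue of `A_n`, and `v`, `w` are corresponding right and left
eigenvectors whose entries with index `c` are equal to `1` (so that they are nonzero). -/
structure IsMaxEigentriple (n c : ℕ) (lam : ℝ) (v w : Fin (n + 1) → ℝ) : Prop where
  isMax : IsMaxEigenvalue (parkingTrunc n) lam
  right : Matrix.mulVec (parkingTrunc n) v = lam • v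
  left : Matrix.vecMul w (parkingTrunc n) = lam • w
  right_norm : padZero v c = 1
  left_norm : padZero w c = 1

/-- Membership in the weighted space `ℓ¹_ρ`. -/
def MemEllOne (ρ : ℝ) (x : ℕ → ℝ) : Prop :=
  Summable fun i => ρ ^ i * |x i|

/-- The norm of `ℓ¹_ρ`. -/
def ellOneNorm (ρ : ℝ) (x : ℕ → ℝ) : ℝ :=
  ∑' i, ρ ^ i * |x i|

theorem memlp_padZero {m : ℕ} (x : Fin m → ℝ) : Memℓp (padZero x) ∞ := by
  refine memℓp_infty ⟨∑ i, |x i|, ?_⟩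
  rintro _ ⟨i, rfl⟩
  by_cases h : i < m
  · simpa [padZero, h] using
      Finset.single_le_sum (f := fun i => |x i|) (fun _ _ => abs_nonneg _)
        (Finset.mem_univ (⟨i, h⟩ : Fin m))
  · simpa [padZero, h] using Finset.sum_nonneg fun i _ => abs_nonneg (x i)

/-- A finite vector, padded by zeroes, as an element of `ℓ^∞`. -/
def padEllInfty {m : ℕ} (x : Fin m → ℝ) : lp (fun _ : ℕ => ℝ) ∞ :=
  ⟨padZero x, memlp_padZero x⟩

end

/-!
Let `T` be the block of the matrix with indices `≥ 2`. It is upper triangular and the sums of the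
absolute values of its columns are at most `1/2`, so `λ - T` is inverted by a back substitution as
soon as `|λ| > 1/2`. For such `λ` the equations of a left eigenvector determine all its entries from
the entry `1`, by a formula which does not depend on the size of the truncation, and what remains of
the eigenvalue equation is the vanishing of the scalar Schur complement
`(λ - A₀₀) (λ - A₁₁) + A₁₀ + ∑ r, (row 1) (λ - T)⁻¹ e_r * A_{r+2,0}`.
As column `0` is small, this function is a small perturbation of a polynomial with roots near
`1/2 + log 2` and `1/2`. It changes sign on `[6/5, 2]`, and it is expansive on `|λ| ≥ 6/5`, which
makes its real root there the only eigenvalue with `|λ| ≥ 6/5`.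

Passing to a larger truncation changes the Schur complement by a tail of column `0`, so by
expansivity the maximum eigenvalues form a Cauchy sequence. The right eigenvectors, normalized in
the entry `0`, solve `(λ - T) u = (column 0)`, and as `T` is bounded by `1/2` in `ℓ¹_3` too, they
form a Cauchy sequence in `ℓ¹_3`; the radius `3` is that of column `0`. The left eigenvectors
converge uniformly, and as the rows of the matrix tend to zero, so do the entries of their limit:
this makes the padding by zeroes harmless in `ℓ^∞`.
-/

noncomputable section

open Finset (range Ico)

section Triangular

variable {𝕜 : Type*} [NormedField 𝕜] {T : ℕ → ℕ → 𝕜} {q ρ B : ℝ} {l l' : 𝕜} {b : ℕ → 𝕜}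

/-- An infinite upper triangular matrix whose columns have `ℓ¹` norm at most `q`; it acts on `ℓ^∞`
from the right with norm at most `q`. -/
structure IsTriangularBounded (T : ℕ → ℕ → 𝕜) (q : ℝ) : Prop where
  eq_zero_of_lt : ∀ {r k : ℕ}, k < r → T r k = 0
  sum_column_le : ∀ k, ∑ r ∈ range (k + 1), ‖T r k‖ ≤ q

namespace IsTriangularBounded

theorem sum_range_norm_le (hT : IsTriangularBounded T q) (m k : ℕ) :
    ∑ r ∈ range m, ‖T r k‖ ≤ q := by
  refine le_trans ?_ (hT.sum_column_le k)
  rw [← Finset.sum_filter_add_sum_filter_not (range m) (· ≤ k),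
    Finset.sum_eq_zero (s := (range m).filter (¬ · ≤ k)), add_zero]
  · refine Finset.sum_le_sum_of_subset_of_nonneg (fun r hr => ?_) fun _ _ _ => norm_nonneg _
    have := (Finset.mem_filter.1 hr).2
    simp only [Finset.mem_range]
    omega
  · intro r hr
    rw [hT.eq_zero_of_lt (not_le.1 (Finset.mem_filter.1 hr).2), norm_zero]

theorem sum_mul_column (hT : IsTriangularBounded T q) (y : ℕ → 𝕜) {k m : ℕ} (hk : k < m) :
    ∑ r ∈ range m, y r * T r k = ∑ r ∈ range (k + 1), y r * T r k := by
  refine (Finset.sum_subset (Finset.range_mono hk) fun r _ hr => ?_).symm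
  rw [hT.eq_zero_of_lt (by simpa using hr), mul_zero]

theorem nonneg (hT : IsTriangularBounded T q) : 0 ≤ q :=
  (Finset.sum_nonneg fun _ _ => norm_nonneg _).trans (hT.sum_column_le 0)

theorem sub_diag_ne_zero (hT : IsTriangularBounded T q) (hl : q < ‖l‖) (k : ℕ) :
    l - T k k ≠ 0 := by
  have hdiag : ‖T k k‖ ≤ q := (Finset.single_le_sum (f := fun r => ‖T r k‖)
    (fun _ _ => norm_nonneg _) (Finset.self_mem_range_succ k)).trans (hT.sum_column_le k)
  intro h
  rw [sub_eq_zero.1 h] at hl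
  exact hl.not_ge hdiag

theorem sum_pow_mul_norm_sum_le (hT : IsTriangularBounded T q) (hρ : 1 ≤ ρ) (x : ℕ → 𝕜) (m : ℕ) :
    ∑ r ∈ range m, ρ ^ r * ‖∑ k ∈ range m, T r k * x k‖ ≤
      q * ∑ k ∈ range m, ρ ^ k * ‖x k‖ := by
  have hρ₀ : 0 ≤ ρ := zero_le_one.trans hρ
  have hentry (r k : ℕ) : ρ ^ r * (‖T r k‖ * ‖x k‖) ≤ ‖T r k‖ * (ρ ^ k * ‖x k‖) := by
    rcases lt_or_ge k r with hkr | hrk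
    · simp only [hT.eq_zero_of_lt hkr, norm_zero, zero_mul, mul_zero, le_refl]
    · rw [mul_left_comm]
      gcongr
  calc ∑ r ∈ range m, ρ ^ r * ‖∑ k ∈ range m, T r k * x k‖
      ≤ ∑ r ∈ range m, ∑ k ∈ range m, ‖T r k‖ * (ρ ^ k * ‖x k‖) := by
        refine Finset.sum_le_sum fun r _ => ?_
        refine (mul_le_mul_of_nonneg_left (norm_sum_le_of_le _ fun k _ => norm_mul_le _ _)
          (pow_nonneg hρ₀ r)).trans ?_
        rw [Finset.mul_sum]
        exact Finset.sum_le_sum fun k _ => hentry r k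
    _ = ∑ k ∈ range m, (∑ r ∈ range m, ‖T r k‖) * (ρ ^ k * ‖x k‖) := by
        rw [Finset.sum_comm]
        simp only [Finset.sum_mul]
    _ ≤ ∑ k ∈ range m, q * (ρ ^ k * ‖x k‖) :=
        Finset.sum_le_sum fun k _ =>
          mul_le_mul_of_nonneg_right (hT.sum_range_norm_le m k) (by positivity)
    _ = q * ∑ k ∈ range m, ρ ^ k * ‖x k‖ := (Finset.mul_sum ..).symm

theorem sum_pow_mul_norm_le_of_right_eq (hT : IsTriangularBounded T q) (hρ : 1 ≤ ρ)
    {x z : ℕ → 𝕜} {m : ℕ} (h : ∀ r < m, l * x r = z r + ∑ k ∈ range m, T r k * x k) :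
    (‖l‖ - q) * ∑ r ∈ range m, ρ ^ r * ‖x r‖ ≤ ∑ r ∈ range m, ρ ^ r * ‖z r‖ := by
  have hρr (r : ℕ) : 0 ≤ ρ ^ r := pow_nonneg (zero_le_one.trans hρ) r
  have hrow : ‖l‖ * ∑ r ∈ range m, ρ ^ r * ‖x r‖ ≤
      ∑ r ∈ range m, ρ ^ r * ‖z r‖ + ∑ r ∈ range m, ρ ^ r * ‖∑ k ∈ range m, T r k * x k‖ := by
    rw [Finset.mul_sum, ← Finset.sum_add_distrib]
    refine Finset.sum_le_sum fun r hr => ?_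
    rw [mul_left_comm, ← mul_add, ← norm_mul, h r (Finset.mem_range.1 hr)]
    exact mul_le_mul_of_nonneg_left (norm_add_le _ _) (hρr r)
  linarith [hT.sum_pow_mul_norm_sum_le hρ x m]

theorem norm_le_of_left_eq (hT : IsTriangularBounded T q) (hl : q < ‖l‖) {y z : ℕ → 𝕜} {m : ℕ}
    (h : ∀ k < m, l * y k = z k + ∑ r ∈ range m, y r * T r k) (hz : ∀ k < m, ‖z k‖ ≤ B) :
    ∀ k < m, ‖y k‖ ≤ B / (‖l‖ - q) := by
  intro k hk
  obtain ⟨p, hp, hmax⟩ := (range m).exists_max_image (fun k => ‖y k‖) ⟨k, Finset.mem_range.2 hk⟩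
  have hp' := Finset.mem_range.1 hp
  have hsum : ‖∑ r ∈ range m, y r * T r p‖ ≤ ‖y p‖ * q := by
    refine (norm_sum_le_of_le _ fun r hr => ?_).trans ((Finset.mul_sum ..).symm.trans_le
      (mul_le_mul_of_nonneg_left (hT.sum_range_norm_le m p) (norm_nonneg _)))
    exact (norm_mul _ _).trans_le (mul_le_mul_of_nonneg_right (hmax r hr) (norm_nonneg _))
  have hcol : ‖l‖ * ‖y p‖ ≤ B + ‖y p‖ * q := by
    rw [← norm_mul, h p hp']
    exact (norm_add_le _ _).trans (add_le_add (hz p hp') hsum)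
  refine (hmax k (Finset.mem_range.2 hk)).trans ?_
  rw [le_div_iff₀ (sub_pos.2 hl)]
  linarith

end IsTriangularBounded

/-- The solution `y` of the row equation `l y - y T = b`, computed entry by entry. -/
def leftResolvent {K : Type*} [Field K] (T : ℕ → ℕ → K) (b : ℕ → K) (l : K) (k : ℕ) : K :=
  (b k + ∑ r : Fin k, leftResolvent T b l r * T r k) / (l - T k k)
decreasing_by exact r.isLt

namespace IsTriangularBounded

theorem mul_leftResolvent (hT : IsTriangularBounded T q) (hl : q < ‖l‖) (b : ℕ → 𝕜) {k m : ℕ}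
    (hk : k < m) :
    l * leftResolvent T b l k = b k + ∑ r ∈ range m, leftResolvent T b l r * T r k := by
  have hdiv : leftResolvent T b l k =
      (b k + ∑ r ∈ range k, leftResolvent T b l r * T r k) / (l - T k k) := by
    rw [leftResolvent, Fin.sum_univ_eq_sum_range fun r => leftResolvent T b l r * T r k]
  rw [eq_div_iff (hT.sub_diag_ne_zero hl k)] at hdiv
  rw [hT.sum_mul_column _ hk, Finset.sum_range_succ]
  linear_combination hdiv

theorem norm_leftResolvent_le (hT : IsTriangularBounded T q) (hl : q < ‖l‖)
    (hb : ∀ k, ‖b k‖ ≤ B) (k : ℕ) : ‖leftResolvent T b l k‖ ≤ B / (‖l‖ - q) :=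
  hT.norm_le_of_left_eq hl (fun _ hj => hT.mul_leftResolvent hl b hj) (fun j _ => hb j) k
    k.lt_succ_self

theorem norm_leftResolvent_sub_le (hT : IsTriangularBounded T q) (hl : q < ‖l‖) (hl' : q < ‖l'‖)
    (hb : ∀ k, ‖b k‖ ≤ B) (k : ℕ) :
    ‖leftResolvent T b l k - leftResolvent T b l' k‖ ≤
      ‖l - l'‖ * (B / (‖l'‖ - q)) / (‖l‖ - q) := by
  refine hT.norm_le_of_left_eq hl
    (y := fun k => leftResolvent T b l k - leftResolvent T b l' k)
    (z := fun k => (l' - l) * leftResolvent T b l' k) (fun j hj => ?_) (fun j _ => ?_) k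
    k.lt_succ_self
  · simp only [sub_mul, Finset.sum_sub_distrib]
    linear_combination hT.mul_leftResolvent hl b hj - hT.mul_leftResolvent hl' b hj
  · rw [norm_mul, norm_sub_rev]
    exact mul_le_mul_of_nonneg_left (hT.norm_leftResolvent_le hl' hb j) (norm_nonneg _)

theorem eq_mul_leftResolvent (hT : IsTriangularBounded T q) (hl : q < ‖l‖) {y : ℕ → 𝕜} {c : 𝕜}
    {m : ℕ} (h : ∀ k < m, l * y k = c * b k + ∑ r ∈ range m, y r * T r k) :
    ∀ k < m, y k = c * leftResolvent T b l k := by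
  intro k hk
  have hzero := hT.norm_le_of_left_eq hl (B := 0)
    (y := fun k => y k - c * leftResolvent T b l k) (z := 0) (fun j hj => ?_)
    (fun j _ => by simp) k hk
  · rwa [zero_div, norm_le_zero_iff, sub_eq_zero] at hzero
  · simp only [sub_mul, Finset.sum_sub_distrib, mul_assoc, ← Finset.mul_sum, Pi.zero_apply]
    linear_combination h j hj - c * hT.mul_leftResolvent hl b hj

theorem continuousOn_leftResolvent (hT : IsTriangularBounded T q) (b : ℕ → 𝕜) (k : ℕ) :
    ContinuousOn (fun l => leftResolvent T b l k) {l | q < ‖l‖} := by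
  induction k using Nat.strong_induction_on with
  | _ k ih =>
    simp_rw [leftResolvent.eq_def T b _ k]
    exact (continuousOn_const.add (continuousOn_finsetSum _ fun (r : Fin k) _ =>
      (ih r r.isLt).mul continuousOn_const)).div (continuousOn_id.sub continuousOn_const)
      fun l hl => hT.sub_diag_ne_zero hl k

end IsTriangularBounded

theorem tendsto_zero_of_eventually_norm_le_mul {α E : Type*} [SeminormedAddCommGroup E]
    {F : Filter α} {f : α → E} {M θ : ℝ} (hθ₀ : 0 < θ) (hθ₁ : θ < 1) (hM₀ : 0 < M)
    (hM : ∀ᶠ a in F, ‖f a‖ ≤ M)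
    (h : ∀ C > 0, (∀ᶠ a in F, ‖f a‖ ≤ C) → ∀ᶠ a in F, ‖f a‖ ≤ θ * C) : Tendsto f F (𝓝 0) := by
  have hpow (n : ℕ) : ∀ᶠ a in F, ‖f a‖ ≤ θ ^ n * M := by
    induction n with
    | zero => simpa only [pow_zero, one_mul] using hM
    | succ n ih => simpa only [pow_succ', mul_assoc] using h _ (by positivity) ih
  have hlim : Tendsto (fun n => θ ^ n * M) atTop (𝓝 0) := by
    simpa only [zero_mul] using (tendsto_pow_atTop_nhds_zero_of_lt_one hθ₀.le hθ₁).mul_const M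
  refine NormedAddGroup.tendsto_nhds_zero.2 fun ε hε => ?_
  obtain ⟨n, hn⟩ := (hlim.eventually_lt_const hε).exists
  exact (hpow n).mono fun a ha => ha.trans_lt hn

namespace IsTriangularBounded

theorem norm_sum_mul_le_of_tail_le (hT : IsTriangularBounded T q) {y : ℕ → 𝕜} {C : ℝ} {N k : ℕ}
    (hC : ∀ r ≥ N, ‖y r‖ ≤ C) (hNk : N ≤ k) :
    ‖∑ r ∈ range (k + 1), y r * T r k‖ ≤ ∑ r ∈ range N, ‖y r‖ * ‖T r k‖ + C * q := by
  have hC₀ : 0 ≤ C := (norm_nonneg _).trans (hC N le_rfl)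
  calc ‖∑ r ∈ range (k + 1), y r * T r k‖
      ≤ ∑ r ∈ range (k + 1), ‖y r‖ * ‖T r k‖ := norm_sum_le_of_le _ fun r _ => norm_mul_le _ _
    _ = ∑ r ∈ range N, ‖y r‖ * ‖T r k‖ + ∑ r ∈ Ico N (k + 1), ‖y r‖ * ‖T r k‖ :=
        (Finset.sum_range_add_sum_Ico _ (by omega)).symm
    _ ≤ ∑ r ∈ range N, ‖y r‖ * ‖T r k‖ + C * q := by
        gcongr
        calc ∑ r ∈ Ico N (k + 1), ‖y r‖ * ‖T r k‖
            ≤ ∑ r ∈ Ico N (k + 1), C * ‖T r k‖ := Finset.sum_le_sum fun r hr =>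
              mul_le_mul_of_nonneg_right (hC r (Finset.mem_Ico.1 hr).1) (norm_nonneg _)
          _ ≤ ∑ r ∈ range (k + 1), C * ‖T r k‖ :=
              Finset.sum_le_sum_of_subset_of_nonneg
                (fun r hr => Finset.mem_range.2 (Finset.mem_Ico.1 hr).2)
                fun _ _ _ => by positivity
          _ ≤ C * q := by
              rw [← Finset.mul_sum]
              exact mul_le_mul_of_nonneg_left (hT.sum_column_le k) hC₀

theorem tendsto_leftResolvent (hT : IsTriangularBounded T q) (hl : q < ‖l‖)
    (hb : Tendsto b atTop (𝓝 0)) (hrow : ∀ r, Tendsto (T r) atTop (𝓝 0)) :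
    Tendsto (leftResolvent T b l) atTop (𝓝 0) := by
  have hq := hT.nonneg
  have hl₀ : 0 < ‖l‖ := hq.trans_lt hl
  obtain ⟨B, hB⟩ := hb.norm.bddAbove_range
  have hbd := hT.norm_leftResolvent_le hl fun k => hB ⟨k, rfl⟩
  have hM₀ : 0 < |B / (‖l‖ - q)| + 1 := by positivity
  refine tendsto_zero_of_eventually_norm_le_mul (θ := (q + ‖l‖) / (2 * ‖l‖)) (by positivity)
    ((div_lt_one (by positivity)).2 (by linarith)) hM₀
    (Eventually.of_forall fun k => (hbd k).trans (by linarith [le_abs_self (B / (‖l‖ - q))]))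
    fun C hC hev => ?_
  obtain ⟨N, hN⟩ := eventually_atTop.1 hev
  have hsmall : Tendsto (fun k => ‖b k‖ + ∑ r ∈ range N, ‖leftResolvent T b l r‖ * ‖T r k‖)
      atTop (𝓝 0) := by
    simpa only [norm_zero, mul_zero, Finset.sum_const_zero, add_zero] using
      hb.norm.add (tendsto_finsetSum _ fun r _ => (hrow r).norm.const_mul _)
  have hgap : 0 < C * (‖l‖ - q) / 2 := by have := sub_pos.2 hl; positivity
  filter_upwards [hsmall.eventually_lt_const hgap, eventually_ge_atTop N] with k hk hNk
  have hcol : ‖l‖ * ‖leftResolvent T b l k‖ ≤ ‖b k‖ +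
      (∑ r ∈ range N, ‖leftResolvent T b l r‖ * ‖T r k‖ + C * q) := by
    rw [← norm_mul, hT.mul_leftResolvent hl b k.lt_succ_self]
    exact (norm_add_le _ _).trans
      (add_le_add_right (hT.norm_sum_mul_le_of_tail_le hN hNk) _)
  rw [div_mul_eq_mul_div, le_div_iff₀ (by positivity)]
  linarith

end IsTriangularBounded

end Triangular

section Bordered

theorem sum_range_add_two {M : Type*} [AddCommMonoid M] (f : ℕ → M) (m : ℕ) :
    ∑ i ∈ range (m + 2), f i = f 0 + f 1 + ∑ r ∈ range m, f (r + 2) := by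
  rw [Finset.sum_range_succ', Finset.sum_range_succ']
  abel

theorem forall_lt_add_two {p : ℕ → Prop} {m : ℕ} :
    (∀ i < m + 2, p i) ↔ p 0 ∧ p 1 ∧ ∀ r < m, p (r + 2) := by
  rw [Nat.forall_lt_succ_left, Nat.forall_lt_succ_left]

theorem hasEigenvalue_toLin'_transpose_iff {ι K : Type*} [Fintype ι] [DecidableEq ι] [Field K]
    {M : Matrix ι ι K} {l : K} :
    Module.End.HasEigenvalue (Matrix.toLin' M.transpose) l ↔
      Module.End.HasEigenvalue (Matrix.toLin' M) l := by
  simp only [Module.End.hasEigenvalue_iff_isRoot_charpoly, Matrix.charpoly_toLin',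
    Matrix.charpoly_transpose]

theorem hasEigenvalue_toLin'_iff_exists_vecMul {ι K : Type*} [Fintype ι] [DecidableEq ι] [Field K]
    {M : Matrix ι ι K} {l : K} :
    Module.End.HasEigenvalue (Matrix.toLin' M) l ↔ ∃ w ≠ 0, Matrix.vecMul w M = l • w := by
  rw [← hasEigenvalue_toLin'_transpose_iff]
  simp only [Module.End.hasEigenvalue_iff, Submodule.ne_bot_iff, Module.End.mem_eigenspace_iff,
    Matrix.toLin'_apply, Matrix.mulVec_transpose, and_comm]

theorem hasEigenvalue_toLin'_map {ι K K' : Type*} [Fintype ι] [DecidableEq ι] [Field K] [Field K']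
    {M : Matrix ι ι K} {l : K} (h : Module.End.HasEigenvalue (Matrix.toLin' M) l) (f : K →+* K') :
    Module.End.HasEigenvalue (Matrix.toLin' (M.map f)) (f l) := by
  rw [Module.End.hasEigenvalue_iff_isRoot_charpoly, Matrix.charpoly_toLin'] at h ⊢
  rw [Matrix.charpoly_map]
  exact h.map

variable {𝕜 : Type*} [NormedField 𝕜] {A : ℕ → ℕ → 𝕜} {q B s ρ : ℝ} {l l' : 𝕜} {m m' : ℕ}

/-- The `n × n` principal submatrix of an infinite matrix. -/
def truncation {R : Type*} (A : ℕ → ℕ → R) (n : ℕ) : Matrix (Fin n) (Fin n) R :=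
  Matrix.of fun i j => A i j

theorem vecMul_truncation_eq_smul_iff {R : Type*} [Semiring R] {A : ℕ → ℕ → R} {n : ℕ} {l : R}
    {u : ℕ → R} :
    Matrix.vecMul (fun i : Fin n => u i) (truncation A n) = l • (fun i : Fin n => u i) ↔
      ∀ j < n, ∑ i ∈ range n, u i * A i j = l * u j := by
  simp only [funext_iff, Fin.forall_iff, Matrix.vecMul, dotProduct, truncation, Matrix.of_apply,
    Pi.smul_apply, smul_eq_mul, ← Fin.sum_univ_eq_sum_range]

theorem mulVec_truncation_eq_smul_iff {R : Type*} [Semiring R] {A : ℕ → ℕ → R} {n : ℕ} {l : R}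
    {u : ℕ → R} :
    Matrix.mulVec (truncation A n) (fun i : Fin n => u i) = l • (fun i : Fin n => u i) ↔
      ∀ i < n, ∑ j ∈ range n, A i j * u j = l * u i := by
  simp only [funext_iff, Fin.forall_iff, Matrix.mulVec, dotProduct, truncation, Matrix.of_apply,
    Pi.smul_apply, smul_eq_mul, ← Fin.sum_univ_eq_sum_range]

/-- The shape of the coefficient matrix `A` and the size of its parts: a triangular block with
column sums at most `q` from index `2` on, whose left border is supported in row `1` (entries at
most `B`) and whose top border is supported in column `0` (sum of the entries at most `s`). -/
structure IsBordered (A : ℕ → ℕ → 𝕜) (q B s : ℝ) : Prop where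
  zero_one : A 0 1 = -1
  zero_add_two : ∀ k, A 0 (k + 2) = 0
  add_two_one : ∀ r, A (r + 2) 1 = 0
  block : IsTriangularBounded (fun r k => A (r + 2) (k + 2)) q
  norm_row_le : ∀ k, ‖A 1 (k + 2)‖ ≤ B
  sum_norm_col_le : ∀ m, ∑ r ∈ range m, ‖A (r + 2) 0‖ ≤ s

/-- The row vector `y` with `y 1 = 1` which satisfies all columns of the equation `y A = l y` except
column `0`. -/
def leftEigenseq {K : Type*} [Field K] (A : ℕ → ℕ → K) (l : K) : ℕ → K
  | 0 => A 1 1 - l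
  | 1 => 1
  | k + 2 => leftResolvent (fun r k => A (r + 2) (k + 2)) (fun k => A 1 (k + 2)) l k

/-- The defect of `leftEigenseq` in column `0` of the truncation of size `m + 2`; its zeroes are the
eigenvalues of the truncation that are larger than the norm of the block. -/
def charFun {K : Type*} [Field K] (A : ℕ → ℕ → K) (m : ℕ) (l : K) : K :=
  (l - A 0 0) * (l - A 1 1) + A 1 0 + ∑ r ∈ range m, leftEigenseq A l (r + 2) * A (r + 2) 0

/-- `u` is supported on the first `n` indices, where it is a right eigenvector of the truncation of
size `n` for the eigenvalue `l`, or zero. -/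
structure IsRightEigenseq {R : Type*} [Semiring R] (A : ℕ → ℕ → R) (n : ℕ) (l : R) (u : ℕ → R) :
    Prop where
  mul_eq : ∀ i < n, ∑ j ∈ range n, A i j * u j = l * u i
  eq_zero_of_le : ∀ i, n ≤ i → u i = 0

namespace IsBordered

theorem map {𝕜' : Type*} [NormedField 𝕜'] (hA : IsBordered A q B s) (f : 𝕜 →+* 𝕜')
    (hf : ∀ a, ‖f a‖ = ‖a‖) : IsBordered (fun i j => f (A i j)) q B s where
  zero_one := by rw [hA.zero_one, map_neg, map_one]
  zero_add_two k := by rw [hA.zero_add_two, map_zero]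
  add_two_one r := by rw [hA.add_two_one, map_zero]
  block :=
    { eq_zero_of_lt := fun h => (congrArg f (hA.block.eq_zero_of_lt h)).trans (map_zero f)
      sum_column_le := by simpa only [hf] using hA.block.sum_column_le }
  norm_row_le := by simpa only [hf] using hA.norm_row_le
  sum_norm_col_le := by simpa only [hf] using hA.sum_norm_col_le

theorem vecMul_eq_iff (hA : IsBordered A q B s) (hl : q < ‖l‖) {u : ℕ → 𝕜} :
    (∀ j < m + 2, ∑ i ∈ range (m + 2), u i * A i j = l * u j) ↔
      (∀ i < m + 2, u i = u 1 * leftEigenseq A l i) ∧ u 1 * charFun A m l = 0 := by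
  simp only [forall_lt_add_two, sum_range_add_two, hA.zero_one, hA.zero_add_two, hA.add_two_one,
    leftEigenseq, charFun, mul_zero, zero_add, Finset.sum_const_zero, add_zero, mul_one]
  constructor
  · rintro ⟨hcol₀, hcol₁, hcol⟩
    have hu₀ : u 0 = u 1 * (A 1 1 - l) := by linear_combination -hcol₁
    have hu := hA.block.eq_mul_leftResolvent hl (y := fun k => u (k + 2)) (c := u 1)
      (b := fun k => A 1 (k + 2)) fun k hk => (hcol k hk).symm
    refine ⟨⟨hu₀, trivial, hu⟩, ?_⟩
    rw [Finset.sum_congr rfl fun r hr => by rw [hu r (Finset.mem_range.1 hr), mul_assoc],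
      ← Finset.mul_sum] at hcol₀
    linear_combination hcol₀ + (l - A 0 0) * hu₀
  · rintro ⟨⟨hu₀, -, hu⟩, hchar⟩
    refine ⟨?_, by linear_combination -hu₀, fun k hk => ?_⟩
    · rw [Finset.sum_congr rfl fun r hr => by rw [hu r (Finset.mem_range.1 hr), mul_assoc],
        ← Finset.mul_sum]
      linear_combination hchar - (l - A 0 0) * hu₀
    · rw [Finset.sum_congr rfl fun r hr => by rw [hu r (Finset.mem_range.1 hr), mul_assoc],
        ← Finset.mul_sum, hu k hk]
      linear_combination -u 1 * hA.block.mul_leftResolvent hl (fun k => A 1 (k + 2)) hk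

theorem hasEigenvalue_truncation_iff (hA : IsBordered A q B s) (hl : q < ‖l‖) :
    Module.End.HasEigenvalue (Matrix.toLin' (truncation A (m + 2))) l ↔ charFun A m l = 0 := by
  rw [hasEigenvalue_toLin'_iff_exists_vecMul]
  constructor
  · rintro ⟨w, hw₀, hw⟩
    obtain ⟨u, rfl⟩ : ∃ u : ℕ → 𝕜, (fun i : Fin (m + 2) => u i) = w :=
      ⟨Function.extend Fin.val w 0, funext fun i => Fin.val_injective.extend_apply w 0 i⟩
    obtain ⟨hu, hchar⟩ := (hA.vecMul_eq_iff hl).1 (vecMul_truncation_eq_smul_iff.1 hw)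
    refine (mul_eq_zero.1 hchar).resolve_left fun hu₁ => hw₀ (funext fun i => ?_)
    rw [hu i i.isLt, hu₁, zero_mul, Pi.zero_apply]
  · intro hchar
    refine ⟨fun i => leftEigenseq A l i, fun h => one_ne_zero (congrFun h 1),
      vecMul_truncation_eq_smul_iff.2 ((hA.vecMul_eq_iff hl).2 ⟨fun i _ => ?_, ?_⟩)⟩
    · rw [leftEigenseq, one_mul]
    · rw [hchar, mul_zero]

theorem norm_leftEigenseq_add_two_le (hA : IsBordered A q B s) (hl : q < ‖l‖) (k : ℕ) :
    ‖leftEigenseq A l (k + 2)‖ ≤ B / (‖l‖ - q) :=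
  hA.block.norm_leftResolvent_le hl hA.norm_row_le k

theorem norm_leftEigenseq_sub_le (hA : IsBordered A q B s) (hl : q < ‖l‖) (hl' : q < ‖l'‖)
    (i : ℕ) : ‖leftEigenseq A l i - leftEigenseq A l' i‖ ≤
      ‖l - l'‖ * (1 + B / ((‖l‖ - q) * (‖l'‖ - q))) := by
  have hB : 0 ≤ B := (norm_nonneg _).trans (hA.norm_row_le 0)
  have hfrac : 0 ≤ B / ((‖l‖ - q) * (‖l'‖ - q)) :=
    div_nonneg hB (mul_pos (sub_pos.2 hl) (sub_pos.2 hl')).le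
  match i with
  | 0 =>
    rw [leftEigenseq, leftEigenseq, sub_sub_sub_cancel_left, norm_sub_rev]
    exact le_mul_of_one_le_right (norm_nonneg _) (by linarith)
  | 1 =>
    rw [leftEigenseq, leftEigenseq, sub_self, norm_zero]
    positivity
  | k + 2 =>
    refine (hA.block.norm_leftResolvent_sub_le hl hl' hA.norm_row_le k).trans ?_
    rw [mul_div_assoc, div_div, mul_comm (‖l'‖ - q)]
    exact mul_le_mul_of_nonneg_left (by linarith) (norm_nonneg _)

theorem tendsto_leftEigenseq (hA : IsBordered A q B s) (hl : q < ‖l‖)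
    (hrow : ∀ i, Tendsto (A (i + 1)) atTop (𝓝 0)) :
    Tendsto (leftEigenseq A l) atTop (𝓝 0) :=
  (tendsto_add_atTop_iff_nat 2).1 <| hA.block.tendsto_leftResolvent hl
    ((tendsto_add_atTop_iff_nat 2).2 (hrow 0))
    fun r => (tendsto_add_atTop_iff_nat 2).2 (hrow (r + 1))

theorem continuousOn_charFun (hA : IsBordered A q B s) (m : ℕ) :
    ContinuousOn (charFun A m) {l | q < ‖l‖} :=
  (by fun_prop : ContinuousOn (fun l => (l - A 0 0) * (l - A 1 1) + A 1 0) _).add <|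
    continuousOn_finsetSum _ fun r _ =>
      (hA.block.continuousOn_leftResolvent (fun k => A 1 (k + 2)) r).mul continuousOn_const

theorem norm_sub_mul_le_norm_charFun_sub (hA : IsBordered A q B s) (hl : q < ‖l‖)
    (hl' : q < ‖l'‖) (m : ℕ) :
    ‖l - l'‖ * (‖l + l' - A 0 0 - A 1 1‖ - B * s / ((‖l‖ - q) * (‖l'‖ - q))) ≤
      ‖charFun A m l - charFun A m l'‖ := by
  have hq := sub_pos.2 hl
  have hq' := sub_pos.2 hl'
  have hB : 0 ≤ B := (norm_nonneg _).trans (hA.norm_row_le 0)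
  set d := ∑ r ∈ range m, (leftEigenseq A l (r + 2) - leftEigenseq A l' (r + 2)) * A (r + 2) 0
    with hd
  have hsub : (l - l') * (l + l' - A 0 0 - A 1 1) = charFun A m l - charFun A m l' - d := by
    simp only [hd, charFun, sub_mul, Finset.sum_sub_distrib]
    ring
  have hdle : ‖d‖ ≤ ‖l - l'‖ * (B / (‖l'‖ - q)) / (‖l‖ - q) * s := by
    refine (norm_sum_le_of_le _ fun r _ => ?_).trans ((Finset.mul_sum ..).symm.trans_le
      (mul_le_mul_of_nonneg_left (hA.sum_norm_col_le m) (by positivity)))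
    rw [norm_mul]
    exact mul_le_mul_of_nonneg_right
      (hA.block.norm_leftResolvent_sub_le hl hl' hA.norm_row_le r) (norm_nonneg _)
  have htri := (congrArg norm hsub).trans_le (norm_sub_le _ _)
  rw [norm_mul] at htri
  have heq : ‖l - l'‖ * (B / (‖l'‖ - q)) / (‖l‖ - q) * s =
      ‖l - l'‖ * (B * s / ((‖l‖ - q) * (‖l'‖ - q))) := by
    field_simp
  rw [mul_sub, ← heq]
  linarith

theorem norm_charFun_sub_le (hA : IsBordered A q B s) (hl : q < ‖l‖) (hm : m ≤ m') :
    ‖charFun A m' l - charFun A m l‖ ≤ B / (‖l‖ - q) * ∑ r ∈ Ico m m', ‖A (r + 2) 0‖ := by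
  have hsub : charFun A m' l - charFun A m l =
      ∑ r ∈ Ico m m', leftEigenseq A l (r + 2) * A (r + 2) 0 := by
    rw [Finset.sum_Ico_eq_sub _ hm, charFun, charFun]
    ring
  rw [hsub, Finset.mul_sum]
  refine norm_sum_le_of_le _ fun r _ => ?_
  rw [norm_mul]
  exact mul_le_mul_of_nonneg_right (hA.norm_leftEigenseq_add_two_le hl r) (norm_nonneg _)

end IsBordered

namespace IsRightEigenseq

variable {n : ℕ} {u u' : ℕ → 𝕜}

theorem smul {R : Type*} [CommSemiring R] {A : ℕ → ℕ → R} {l : R} {u : ℕ → R}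
    (hu : IsRightEigenseq A n l u) (a : R) : IsRightEigenseq A n l (a • u) where
  mul_eq i hi := by
    simp only [Pi.smul_apply, smul_eq_mul, mul_left_comm _ a, ← Finset.mul_sum, hu.mul_eq i hi]
  eq_zero_of_le i hi := by rw [Pi.smul_apply, hu.eq_zero_of_le i hi, smul_zero]

theorem apply_one (hu : IsRightEigenseq A (m + 2) l u) (hA : IsBordered A q B s) :
    u 1 = (A 0 0 - l) * u 0 := by
  have hrow := hu.mul_eq 0 (by omega)
  simp only [sum_range_add_two, hA.zero_one, hA.zero_add_two, zero_mul, Finset.sum_const_zero]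
    at hrow
  linear_combination -hrow

theorem mul_apply_add_two (hu : IsRightEigenseq A (m + 2) l u) (hA : IsBordered A q B s) {r : ℕ}
    (hr : r < m) :
    l * u (r + 2) = A (r + 2) 0 * u 0 + ∑ k ∈ range m, A (r + 2) (k + 2) * u (k + 2) := by
  have hrow := hu.mul_eq (r + 2) (by omega)
  rw [sum_range_add_two, hA.add_two_one, zero_mul, add_zero] at hrow
  exact hrow.symm

theorem sum_pow_mul_norm_le (hu : IsRightEigenseq A (m + 2) l u) (hA : IsBordered A q B s)
    (hρ : 1 ≤ ρ) :
    (‖l‖ - q) * ∑ r ∈ range m, ρ ^ r * ‖u (r + 2)‖ ≤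
      (∑ r ∈ range m, ρ ^ r * ‖A (r + 2) 0‖) * ‖u 0‖ := by
  refine (hA.block.sum_pow_mul_norm_le_of_right_eq hρ fun r hr =>
    hu.mul_apply_add_two hA hr).trans_eq ?_
  simp only [norm_mul, Finset.sum_mul, mul_assoc]

theorem eq_zero (hu : IsRightEigenseq A (m + 2) l u) (hA : IsBordered A q B s) (hl : q < ‖l‖)
    (hu₀ : u 0 = 0) : u = 0 := by
  have hsum := hu.sum_pow_mul_norm_le hA le_rfl
  simp only [hu₀, norm_zero, mul_zero, one_pow, one_mul] at hsum
  have hzero : ∑ r ∈ range m, ‖u (r + 2)‖ = 0 :=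
    le_antisymm (nonpos_of_mul_nonpos_right hsum (sub_pos.2 hl))
      (Finset.sum_nonneg fun _ _ => norm_nonneg _)
  rw [Finset.sum_eq_zero_iff_of_nonneg fun _ _ => norm_nonneg _] at hzero
  have hlt : ∀ i < m + 2, u i = 0 := forall_lt_add_two.2
    ⟨hu₀, by rw [hu.apply_one hA, hu₀, mul_zero],
      fun r hr => norm_eq_zero.1 (hzero r (Finset.mem_range.2 hr))⟩
  exact funext fun i => (lt_or_ge i (m + 2)).elim (hlt i) (hu.eq_zero_of_le i)

theorem sum_pow_mul_norm_sub_le (hu : IsRightEigenseq A (m + 2) l u)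
    (hu' : IsRightEigenseq A (m' + 2) l' u') (hA : IsBordered A q B s) (hm : m ≤ m')
    (h₀ : u' 0 = u 0) (hρ : 1 ≤ ρ) :
    (‖l'‖ - q) * ∑ r ∈ range m', ρ ^ r * ‖u' (r + 2) - u (r + 2)‖ ≤
      ‖l - l'‖ * ∑ r ∈ range m, ρ ^ r * ‖u (r + 2)‖ +
        (∑ r ∈ Ico m m', ρ ^ r * ‖A (r + 2) 0‖) * ‖u 0‖ := by
  have hblock (r : ℕ) : ∑ k ∈ range m', A (r + 2) (k + 2) * u (k + 2) =
      ∑ k ∈ range m, A (r + 2) (k + 2) * u (k + 2) :=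
    (Finset.sum_subset (Finset.range_mono hm) fun k _ hk => by
      rw [hu.eq_zero_of_le (k + 2) (by simpa using hk), mul_zero]).symm
  refine (hA.block.sum_pow_mul_norm_le_of_right_eq hρ (x := fun r => u' (r + 2) - u (r + 2))
    (z := fun r => if r < m then (l - l') * u (r + 2) else A (r + 2) 0 * u 0)
    fun r hr => ?_).trans_eq ?_
  · simp only [mul_sub, Finset.sum_sub_distrib, hblock, hu'.mul_apply_add_two hA hr, h₀]
    split_ifs with hrm
    · linear_combination -hu.mul_apply_add_two hA hrm
    · have hvanish : ∑ k ∈ range m, A (r + 2) (k + 2) * u (k + 2) = 0 :=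
        Finset.sum_eq_zero fun k hk => by
          rw [hA.block.eq_zero_of_lt ((Finset.mem_range.1 hk).trans_le (not_lt.1 hrm)), zero_mul]
      rw [hvanish, hu.eq_zero_of_le (r + 2) (by omega)]
      ring
  · rw [← Finset.sum_range_add_sum_Ico _ hm, Finset.mul_sum, Finset.sum_mul]
    congr 1
    · refine Finset.sum_congr rfl fun r hr => ?_
      rw [if_pos (Finset.mem_range.1 hr), norm_mul, mul_left_comm]
    · refine Finset.sum_congr rfl fun r hr => ?_
      rw [if_neg (Finset.mem_Ico.1 hr).1.not_gt, norm_mul, mul_assoc]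

end IsRightEigenseq

end Bordered

section Entries

theorem parkingMatrix_add_two_add_two (r k : ℕ) :
    parkingMatrix (r + 2) (k + 2) =
      (k + 1).choose (r + 1) * ((-1) ^ (k + r) - 2 / ((k : ℝ) + 1)) / 2 ^ (k + 2) := by
  rw [parkingMatrix]
  field_simp
  ring

theorem abs_parkingMatrix_add_two_add_two (r : ℕ) {k : ℕ} (hk : k ≠ 0) :
    |parkingMatrix (r + 2) (k + 2)| =
      (k + 1).choose (r + 1) * (1 - (-1) ^ (k + r) * (2 / ((k : ℝ) + 1))) / 2 ^ (k + 2) := by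
  have hle : 2 / ((k : ℝ) + 1) ≤ 1 := by
    rw [div_le_one (by positivity)]
    linarith [Nat.one_le_cast (α := ℝ).2 (Nat.one_le_iff_ne_zero.2 hk)]
  have hnonneg : 0 ≤ 2 / ((k : ℝ) + 1) := by positivity
  have hsign : |(-1) ^ (k + r) - 2 / ((k : ℝ) + 1)| = 1 - (-1) ^ (k + r) * (2 / ((k : ℝ) + 1)) := by
    rcases neg_one_pow_eq_or ℝ (k + r) with h | h <;> rw [h]
    · rw [abs_of_nonneg (by linarith), one_mul]
    · rw [abs_of_nonpos (by linarith)]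
      ring
  rw [parkingMatrix_add_two_add_two, abs_div, abs_mul, hsign, Nat.abs_cast,
    abs_of_pos (by positivity : (0 : ℝ) < 2 ^ (k + 2))]

theorem sum_range_choose_mul_one_add_neg_one_pow_mul {n : ℕ} (hn : n ≠ 0) (t : ℝ) :
    ∑ j ∈ range (n + 1), (n.choose j : ℝ) * (1 + (-1) ^ j * t) = 2 ^ n := by
  have hsum : ∑ j ∈ range (n + 1), (n.choose j : ℝ) = 2 ^ n := mod_cast n.sum_range_choose
  have halt : ∑ j ∈ range (n + 1), (-1 : ℝ) ^ j * n.choose j = 0 :=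
    mod_cast Int.alternating_sum_range_choose_of_ne hn
  simp only [mul_add, mul_one, Finset.sum_add_distrib, hsum, ← mul_assoc, mul_comm _ ((-1 : ℝ) ^ _),
    ← Finset.sum_mul, halt, zero_mul, add_zero]

theorem sum_range_succ_abs_parkingMatrix_le (k : ℕ) :
    ∑ r ∈ range (k + 1), |parkingMatrix (r + 2) (k + 2)| ≤ 1 / 2 := by
  rcases eq_or_ne k 0 with rfl | hk
  · norm_num [parkingMatrix_add_two_add_two, abs_le]
  have hle : 2 / ((k : ℝ) + 1) ≤ 1 := by
    rw [div_le_one (by positivity)]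
    linarith [Nat.one_le_cast (α := ℝ).2 (Nat.one_le_iff_ne_zero.2 hk)]
  set t := 2 / ((k : ℝ) + 1)
  have ht : 0 ≤ t := by positivity
  have hfirst : 0 ≤ ((k + 1).choose 0 : ℝ) * (1 + (-1) ^ 0 * ((-1) ^ k * t)) := by
    rcases neg_one_pow_eq_or ℝ k with h | h <;> rw [h] <;> norm_num <;> linarith
  have hbinom := sum_range_choose_mul_one_add_neg_one_pow_mul k.add_one_ne_zero ((-1) ^ k * t)
  rw [Finset.sum_range_succ'] at hbinom
  calc ∑ r ∈ range (k + 1), |parkingMatrix (r + 2) (k + 2)|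
      = (∑ r ∈ range (k + 1), ((k + 1).choose (r + 1) : ℝ) *
          (1 + (-1) ^ (r + 1) * ((-1) ^ k * t))) / 2 ^ (k + 2) := by
        rw [Finset.sum_div]
        refine Finset.sum_congr rfl fun r _ => ?_
        rw [abs_parkingMatrix_add_two_add_two r hk]
        ring
    _ ≤ 2 ^ (k + 1) / 2 ^ (k + 2) := by
        gcongr
        linarith
    _ = 1 / 2 := by
        rw [pow_succ (2 : ℝ) (k + 1)]
        field_simp

theorem isTriangularBounded_parkingMatrix :
    IsTriangularBounded (fun r k => parkingMatrix (r + 2) (k + 2)) (1 / 2) where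
  eq_zero_of_lt h := by
    rw [parkingMatrix_add_two_add_two, Nat.choose_eq_zero_of_lt (by omega), Nat.cast_zero,
      zero_mul, zero_div]
  sum_column_le := sum_range_succ_abs_parkingMatrix_le

theorem tendsto_choose_div_two_pow (r : ℕ) :
    Tendsto (fun k : ℕ => (k.choose r : ℝ) / 2 ^ k) atTop (𝓝 0) := by
  refine squeeze_zero (fun k => by positivity) (fun k => ?_)
    (tendsto_pow_const_div_const_pow_of_one_lt r (one_lt_two (α := ℝ)))
  gcongr
  exact_mod_cast Nat.choose_le_pow k r

theorem abs_parkingMatrix_one_add_two_le_add (k : ℕ) :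
    |parkingMatrix 1 (k + 2)| ≤ 1 / ((k : ℝ) + 1) + (1 / 2) ^ (k + 2) := by
  have hsplit : parkingMatrix 1 (k + 2) =
      1 / ((k : ℝ) + 1) * (1 - (1 / 2) ^ (k + 1)) + (-1) ^ (k + 1) * (1 / 2) ^ (k + 2) := by
    rw [parkingMatrix, one_div_pow, one_div_pow]
    field_simp
    ring
  have hle : (1 / 2 : ℝ) ^ (k + 1) ≤ 1 := pow_le_one₀ (by norm_num) (by norm_num)
  have hpos : (0 : ℝ) < (1 / 2) ^ (k + 1) := by positivity
  rw [hsplit]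
  refine (abs_add_le _ _).trans (add_le_add ?_ ?_)
  · rw [abs_of_nonneg (mul_nonneg (by positivity) (by linarith))]
    exact mul_le_of_le_one_right (by positivity) (by linarith)
  · rw [abs_mul, abs_pow, abs_neg, abs_one, one_pow, one_mul, abs_of_nonneg (by positivity)]

theorem abs_parkingMatrix_one_add_two_le (k : ℕ) : |parkingMatrix 1 (k + 2)| ≤ 1 / 2 := by
  match k with
  | 0 => norm_num [parkingMatrix, abs_le]
  | 1 => norm_num [parkingMatrix, abs_le]
  | k + 2 =>
    have hinv : 1 / (((k + 2 : ℕ) : ℝ) + 1) ≤ 1 / 3 :=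
      one_div_le_one_div_of_le (by norm_num) (by push_cast; linarith [k.cast_nonneg (α := ℝ)])
    have hpow : (1 / 2 : ℝ) ^ (k + 2 + 2) ≤ (1 / 2) ^ 4 :=
      pow_le_pow_of_le_one (by norm_num) (by norm_num) (by omega)
    linarith [abs_parkingMatrix_one_add_two_le_add (k + 2)]

theorem tendsto_parkingMatrix_row (i : ℕ) :
    Tendsto (parkingMatrix (i + 1)) atTop (𝓝 0) := by
  refine (tendsto_add_atTop_iff_nat 2).1 ?_
  match i with
  | 0 =>
    refine squeeze_zero_norm abs_parkingMatrix_one_add_two_le_add ?_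
    simpa only [add_zero] using tendsto_one_div_add_atTop_nhds_zero_nat.add
      ((tendsto_add_atTop_iff_nat 2).2
        (tendsto_pow_atTop_nhds_zero_of_lt_one (r := (1 / 2 : ℝ)) (by norm_num) (by norm_num)))
  | r + 1 =>
    have hlim := (tendsto_add_atTop_iff_nat 1).2 (tendsto_choose_div_two_pow (r + 1))
    refine squeeze_zero_norm (fun k => ?_) (by simpa only [mul_zero] using hlim.const_mul (3 / 2))
    have hfrac : 2 / ((k : ℝ) + 1) ≤ 2 :=
      div_le_self zero_le_two (le_add_of_nonneg_left k.cast_nonneg)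
    have hfrac₀ : 0 ≤ 2 / ((k : ℝ) + 1) := by positivity
    have hentry : |(-1) ^ (k + r) - 2 / ((k : ℝ) + 1)| ≤ 3 := by
      rw [abs_le]
      rcases neg_one_pow_eq_or ℝ (k + r) with h | h <;> rw [h] <;> constructor <;> linarith
    rw [parkingMatrix_add_two_add_two, Real.norm_eq_abs, abs_div, abs_mul, Nat.abs_cast,
      abs_of_pos (by positivity : (0 : ℝ) < 2 ^ (k + 2)), pow_succ (2 : ℝ) (k + 1)]
    calc (k + 1).choose (r + 1) * |(-1) ^ (k + r) - 2 / ((k : ℝ) + 1)| / (2 ^ (k + 1) * 2)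
        ≤ (k + 1).choose (r + 1) * 3 / (2 ^ (k + 1) * 2) := by gcongr
      _ = 3 / 2 * ((k + 1).choose (r + 1) / 2 ^ (k + 1)) := by ring

/-- The tail `∑_{j ≥ r + 1} 1 / (j 3 ^ j)` of the logarithmic series. -/
def logTail (r : ℕ) : ℝ := ∑' j : ℕ, 1 / (((r : ℝ) + 1 + j) * 3 ^ (r + 1 + j))

theorem parkingMatrix_add_two_zero (r : ℕ) :
    parkingMatrix (r + 2) 0 = (-1) ^ (r + 1) / ((r : ℝ) + 1) * logTail r := by
  rw [parkingMatrix, logTail]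

theorem logTail_term_le (r j : ℕ) : 1 / (((r : ℝ) + 1 + j) * 3 ^ (r + 1 + j)) ≤
    1 / (((r : ℝ) + 1) * 3 ^ (r + 1)) * (1 / 3) ^ j := by
  have hle : (r : ℝ) + 1 ≤ r + 1 + j := le_add_of_nonneg_right j.cast_nonneg
  rw [one_div_pow, one_div_mul_one_div, pow_add _ (r + 1), ← mul_assoc]
  gcongr

theorem summable_logTail (r : ℕ) :
    Summable fun j : ℕ => 1 / (((r : ℝ) + 1 + j) * 3 ^ (r + 1 + j)) :=
  Summable.of_nonneg_of_le (fun _ => by positivity) (logTail_term_le r)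
    ((summable_geometric_of_lt_one (by norm_num) (by norm_num)).mul_left _)

theorem logTail_nonneg (r : ℕ) : 0 ≤ logTail r := tsum_nonneg fun _ => by positivity

theorem logTail_eq_add_succ (r : ℕ) :
    logTail r = 1 / (((r : ℝ) + 1) * 3 ^ (r + 1)) + logTail (r + 1) := by
  rw [logTail, (summable_logTail r).tsum_eq_zero_add, Nat.cast_zero, add_zero, add_zero, logTail]
  congr 1
  refine tsum_congr fun j => ?_
  push_cast
  ring_nf

theorem logTail_le (r : ℕ) : logTail r ≤ 1 / (2 * ((r : ℝ) + 1) * 3 ^ r) := by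
  refine ((summable_logTail r).tsum_le_tsum (logTail_term_le r)
    ((summable_geometric_of_lt_one (by norm_num) (by norm_num)).mul_left _)).trans_eq ?_
  rw [tsum_mul_left, tsum_geometric_of_lt_one (by norm_num) (by norm_num), pow_succ]
  field_simp
  norm_num

theorem abs_parkingMatrix_add_two_zero (r : ℕ) :
    |parkingMatrix (r + 2) 0| = logTail r / ((r : ℝ) + 1) := by
  rw [parkingMatrix_add_two_zero, abs_mul, abs_div, abs_pow, abs_neg, abs_one, one_pow,
    abs_of_nonneg (logTail_nonneg r), abs_of_pos (by positivity : (0 : ℝ) < r + 1),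
    one_div_mul_eq_div]

theorem abs_parkingMatrix_add_two_zero_le (r : ℕ) :
    |parkingMatrix (r + 2) 0| ≤ 1 / (2 * ((r : ℝ) + 1) ^ 2 * 3 ^ r) := by
  rw [abs_parkingMatrix_add_two_zero]
  refine (div_le_div_of_nonneg_right (logTail_le r) (by positivity)).trans_eq ?_
  field_simp

theorem sum_Ico_abs_parkingMatrix_add_two_zero_le (p m : ℕ) :
    ∑ r ∈ Ico p m, |parkingMatrix (r + 2) 0| ≤ 3 / (4 * ((p : ℝ) + 1) ^ 2 * 3 ^ p) := by
  have hterm (r : ℕ) : |parkingMatrix (p + r + 2) 0| ≤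
      1 / (2 * ((p : ℝ) + 1) ^ 2 * 3 ^ p) * (1 / 3) ^ r := by
    refine (abs_parkingMatrix_add_two_zero_le _).trans ?_
    rw [one_div_pow, one_div_mul_one_div, pow_add, ← mul_assoc]
    gcongr
    exact Nat.le_add_right p r
  have hgeom : ∑ r ∈ range (m - p), (1 / 3 : ℝ) ^ r ≤ 3 / 2 :=
    ((summable_geometric_of_lt_one (by norm_num) (by norm_num)).sum_le_tsum _
      fun _ _ => by positivity).trans_eq (by
        rw [tsum_geometric_of_lt_one (by norm_num) (by norm_num)]; norm_num)
  rw [Finset.sum_Ico_eq_sum_range]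
  refine (Finset.sum_le_sum fun r _ => hterm r).trans ?_
  rw [← Finset.mul_sum]
  refine (mul_le_mul_of_nonneg_left hgeom (by positivity)).trans_eq ?_
  field_simp
  norm_num

theorem sum_Ico_one_abs_parkingMatrix_le (m : ℕ) :
    ∑ r ∈ Ico 1 m, |parkingMatrix (r + 2) 0| ≤ 5 / 108 := by
  rcases le_or_gt m 1 with hm | hm
  · rw [Finset.Ico_eq_empty (not_lt.2 hm), Finset.sum_empty]
    norm_num
  have hfirst : |parkingMatrix 3 0| ≤ 1 / 27 := by
    have hlog := logTail_eq_add_succ 1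
    have hnext := logTail_le 2
    rw [abs_parkingMatrix_add_two_zero 1]
    norm_num at hlog hnext ⊢
    linarith
  have hrest := sum_Ico_abs_parkingMatrix_add_two_zero_le 2 m
  rw [Finset.sum_eq_sum_Ico_succ_bot hm]
  norm_num at hfirst hrest ⊢
  linarith

theorem sum_abs_parkingMatrix_add_two_zero_le (m : ℕ) :
    ∑ r ∈ range m, |parkingMatrix (r + 2) 0| ≤ 9 / 16 := by
  rcases m.eq_zero_or_pos with rfl | hm
  · norm_num
  have hfirst := abs_parkingMatrix_add_two_zero_le 0
  have hrest := sum_Ico_one_abs_parkingMatrix_le m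
  rw [Finset.range_eq_Ico, Finset.sum_eq_sum_Ico_succ_bot hm]
  norm_num at hfirst hrest ⊢
  linarith

theorem summable_pow_mul_abs_parkingMatrix_add_two_zero :
    Summable fun r => 3 ^ r * |parkingMatrix (r + 2) 0| := by
  have hsq : Summable fun r : ℕ => (1 / 2 : ℝ) * (1 / ((r + 1 : ℕ) : ℝ) ^ 2) :=
    ((summable_nat_add_iff 1).2 (Real.summable_one_div_nat_pow.2 one_lt_two)).mul_left _
  refine Summable.of_nonneg_of_le (fun _ => by positivity) (fun r => ?_) hsq
  refine (mul_le_mul_of_nonneg_left (abs_parkingMatrix_add_two_zero_le r) (by positivity)).trans_eq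
    ?_
  push_cast
  field_simp

theorem isBordered_parkingMatrix : IsBordered parkingMatrix (1 / 2) (1 / 2) (9 / 16) where
  zero_one := by rw [parkingMatrix]
  zero_add_two k := by rw [parkingMatrix]
  add_two_one r := by rw [parkingMatrix]
  block := isTriangularBounded_parkingMatrix
  norm_row_le := abs_parkingMatrix_one_add_two_le
  sum_norm_col_le := sum_abs_parkingMatrix_add_two_zero_le

theorem isBordered_parkingMatrix_complex :
    IsBordered (fun i j => algebraMap ℝ ℂ (parkingMatrix i j)) (1 / 2) (1 / 2) (9 / 16) :=
  isBordered_parkingMatrix.map (algebraMap ℝ ℂ) (norm_algebraMap' ℂ)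

end Entries

section Corner

theorem parkingMatrix_zero_zero : parkingMatrix 0 0 = 1 / 2 := by rw [parkingMatrix]

theorem parkingMatrix_one_one : parkingMatrix 1 1 = 1 / 2 + Real.log 2 := by rw [parkingMatrix]

theorem abs_dilog_term_le (p k : ℕ) :
    |(-1 : ℝ) ^ (k + p + 1) / ((((k + p : ℕ) : ℝ) + 1) ^ 2 * 2 ^ (k + p + 1))| ≤
      1 / (((p : ℝ) + 1) ^ 2 * 2 ^ (p + 1)) * (1 / 2) ^ k := by
  rw [abs_div, abs_pow, abs_neg, abs_one, one_pow, abs_of_pos (by positivity), one_div_pow,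
    one_div_mul_one_div, mul_assoc, ← pow_add, add_comm (p + 1), ← add_assoc]
  gcongr
  exact Nat.le_add_left p k

theorem abs_tsum_dilog_sub_sum_le (p : ℕ) :
    |∑' k : ℕ, (-1 : ℝ) ^ (k + 1) / (((k : ℝ) + 1) ^ 2 * 2 ^ (k + 1)) -
      ∑ k ∈ range p, (-1 : ℝ) ^ (k + 1) / (((k : ℝ) + 1) ^ 2 * 2 ^ (k + 1))| ≤
      1 / (((p : ℝ) + 1) ^ 2 * 2 ^ p) := by
  have hgeom (p : ℕ) : Summable fun k : ℕ =>
      1 / (((p : ℝ) + 1) ^ 2 * 2 ^ (p + 1)) * (1 / 2 : ℝ) ^ k := summable_geometric_two.mul_left _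
  have hsum : Summable fun k : ℕ => (-1 : ℝ) ^ (k + 1) / (((k : ℝ) + 1) ^ 2 * 2 ^ (k + 1)) :=
    Summable.of_norm_bounded (hgeom 0) (abs_dilog_term_le 0)
  rw [← hsum.sum_add_tsum_nat_add p, add_sub_cancel_left, ← Real.norm_eq_abs]
  refine (tsum_of_norm_bounded (hgeom p).hasSum (abs_dilog_term_le p)).trans_eq ?_
  rw [tsum_mul_left, tsum_geometric_two]
  field_simp
  rw [pow_succ']

theorem parkingMatrix_one_zero_lt : parkingMatrix 1 0 < 28 / 1000 := by
  have hdilog := (abs_le.1 (abs_tsum_dilog_sub_sum_le 7)).2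
  have hpi : Real.pi ^ 2 < 3.1416 ^ 2 :=
    pow_lt_pow_left₀ Real.pi_lt_d4 Real.pi_pos.le two_ne_zero
  rw [parkingMatrix]
  norm_num [Finset.sum_range_succ] at hdilog hpi ⊢
  linarith [Real.log_two_gt_d9]

theorem neg_one_lt_parkingMatrix_one_zero : -1 < parkingMatrix 1 0 := by
  have hdilog := (abs_le.1 (abs_tsum_dilog_sub_sum_le 0)).1
  have hpi : (3 : ℝ) ^ 2 < Real.pi ^ 2 :=
    pow_lt_pow_left₀ Real.pi_gt_three (by norm_num) two_ne_zero
  rw [parkingMatrix]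
  norm_num at hdilog hpi ⊢
  linarith [Real.log_two_lt_d9]

end Corner

section MaxEigenvalue

variable {m m' : ℕ} {l l' : ℝ}

theorem IsBordered.norm_sub_le_eight_mul {𝕜 : Type*} [NormedField 𝕜] {A : ℕ → ℕ → 𝕜} {l l' : 𝕜}
    (hA : IsBordered A (1 / 2) (1 / 2) (9 / 16)) (hl : 6 / 5 ≤ ‖l‖) (hl' : 6 / 5 ≤ ‖l'‖)
    (hdist : ‖A 0 0 + A 1 1 - l'‖ ≤ 1 / 2) (m : ℕ) :
    ‖l - l'‖ ≤ 8 * ‖charFun A m l - charFun A m l'‖ := by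
  have hlinear : 7 / 10 ≤ ‖l + l' - A 0 0 - A 1 1‖ := by
    have htri := norm_sub_norm_le l (A 0 0 + A 1 1 - l')
    rw [show l - (A 0 0 + A 1 1 - l') = l + l' - A 0 0 - A 1 1 by ring] at htri
    linarith
  have htail : (1 / 2 : ℝ) * (9 / 16) / ((‖l‖ - 1 / 2) * (‖l'‖ - 1 / 2)) ≤ 23 / 40 := by
    rw [div_le_iff₀ (mul_pos (by linarith) (by linarith))]
    nlinarith
  have hexp := hA.norm_sub_mul_le_norm_charFun_sub (l := l) (l' := l') (by linarith)
    (by linarith) m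
  have hscale := mul_le_mul_of_nonneg_left (sub_le_sub hlinear htail) (norm_nonneg (l - l'))
  linarith

theorem charFun_parkingMatrix_one_lt : charFun parkingMatrix 1 (6 / 5) < -(5 / 7 * (5 / 108)) := by
  have hlog : 65 / 162 ≤ logTail 0 := by
    have hzero := logTail_eq_add_succ 0
    have hone := logTail_eq_add_succ 1
    have htwo := logTail_eq_add_succ 2
    have hrest := logTail_nonneg 3
    norm_num at hzero hone htwo
    linarith
  have hleft : leftEigenseq parkingMatrix (6 / 5) 2 = 5 / 29 := by
    norm_num [leftEigenseq, leftResolvent, parkingMatrix]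
  rw [charFun, Finset.sum_range_one, hleft, parkingMatrix_add_two_zero,
    parkingMatrix_zero_zero, parkingMatrix_one_one]
  norm_num
  linarith [parkingMatrix_one_zero_lt, Real.log_two_gt_d9]

theorem abs_charFun_parkingMatrix_sub_le (hm : m ≤ m') (hl : 6 / 5 ≤ l) :
    |charFun parkingMatrix m' l - charFun parkingMatrix m l| ≤
      5 / 7 * ∑ r ∈ Ico m m', |parkingMatrix (r + 2) 0| := by
  have hnorm : ‖l‖ = l := Real.norm_of_nonneg (by linarith)
  refine (isBordered_parkingMatrix.norm_charFun_sub_le (by linarith) hm).trans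
    (mul_le_mul_of_nonneg_right ?_ (Finset.sum_nonneg fun _ _ => norm_nonneg _))
  rw [div_le_iff₀ (by linarith)]
  linarith

theorem charFun_parkingMatrix_neg (hm : 1 ≤ m) : charFun parkingMatrix m (6 / 5) < 0 := by
  have htail := (abs_le.1 (abs_charFun_parkingMatrix_sub_le hm le_rfl)).2
  linarith [charFun_parkingMatrix_one_lt, sum_Ico_one_abs_parkingMatrix_le m]

theorem charFun_parkingMatrix_pos (m : ℕ) : 0 < charFun parkingMatrix m 2 := by
  have htail := (abs_le.1 (isBordered_parkingMatrix.norm_charFun_sub_le (l := 2) (by norm_num)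
    m.zero_le)).1
  have hcol := sum_abs_parkingMatrix_add_two_zero_le m
  have hlead : 1 / 5 < charFun parkingMatrix 0 2 := by
    rw [charFun, Finset.sum_range_zero, parkingMatrix_zero_zero, parkingMatrix_one_one]
    linarith [neg_one_lt_parkingMatrix_one_zero, Real.log_two_lt_d9]
  rw [← Finset.range_eq_Ico] at htail
  norm_num at htail
  linarith

theorem exists_charFun_parkingMatrix_eq_zero (hm : 1 ≤ m) :
    ∃ l ∈ Set.Icc (6 / 5) 2, charFun parkingMatrix m l = 0 := by
  have hcont : ContinuousOn (charFun parkingMatrix m) (Set.Icc (6 / 5) 2) :=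
    (isBordered_parkingMatrix.continuousOn_charFun m).mono fun l hl => by
      rw [Set.mem_ofPred_eq, Real.norm_eq_abs]
      linarith [hl.1, le_abs_self l]
  exact intermediate_value_Icc (by norm_num) hcont
    ⟨(charFun_parkingMatrix_neg hm).le, (charFun_parkingMatrix_pos m).le⟩

theorem abs_parkingMatrix_diag_sub_le (hl : l ∈ Set.Icc (6 / 5) 2) :
    |parkingMatrix 0 0 + parkingMatrix 1 1 - l| ≤ 1 / 2 := by
  rw [parkingMatrix_zero_zero, parkingMatrix_one_one, abs_le]
  constructor <;> linarith [hl.1, hl.2, Real.log_two_gt_d9, Real.log_two_lt_d9]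

theorem IsMaxEigenvalue.unique {n : ℕ} {M : Matrix (Fin n) (Fin n) ℝ} (h : IsMaxEigenvalue M l)
    (h' : IsMaxEigenvalue M l') : l = l' := by
  by_contra hne
  have hlt := h.2 l' h'.1 fun heq => hne (Complex.ofReal_injective heq).symm
  have hlt' := h'.2 l h.1 fun heq => hne (Complex.ofReal_injective heq)
  rw [Complex.norm_real] at hlt hlt'
  exact ((Real.le_norm_self l').trans_lt hlt).asymm ((Real.le_norm_self l).trans_lt hlt')

theorem isMaxEigenvalue_parkingTrunc_of_charFun_eq_zero (hl : l ∈ Set.Icc (6 / 5) 2)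
    (h : charFun parkingMatrix m l = 0) : IsMaxEigenvalue (parkingTrunc (m + 1)) l := by
  have hnorm : ‖(l : ℂ)‖ = l := Complex.norm_of_nonneg (by linarith [hl.1])
  have hnorm' : ‖l‖ = l := Real.norm_of_nonneg (by linarith [hl.1])
  have heig : Module.End.HasEigenvalue
      (Matrix.toLin' ((parkingTrunc (m + 1)).map (algebraMap ℝ ℂ))) (l : ℂ) :=
    hasEigenvalue_toLin'_map ((isBordered_parkingMatrix.hasEigenvalue_truncation_iff
      (by linarith [hl.1])).2 h) (algebraMap ℝ ℂ)
  have hzero (μ : ℂ) (hμ : 6 / 5 ≤ ‖μ‖) := (isBordered_parkingMatrix_complex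
    |>.hasEigenvalue_truncation_iff (m := m) (l := μ) (by linarith)).1
  refine ⟨heig, fun μ hμ hne => lt_of_not_ge fun hle => hne ?_⟩
  have hμ' : 6 / 5 ≤ ‖μ‖ := hl.1.trans hle
  have hl' : 6 / 5 ≤ ‖(l : ℂ)‖ := hl.1.trans_eq hnorm.symm
  have hexp := isBordered_parkingMatrix_complex.norm_sub_le_eight_mul hμ' hl'
    (by simpa only [Complex.coe_algebraMap, ← Complex.ofReal_add, ← Complex.ofReal_sub,
      Complex.norm_real, Real.norm_eq_abs] using abs_parkingMatrix_diag_sub_le hl) m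
  rw [hzero μ hμ' hμ, hzero l hl' heig, sub_self, norm_zero, mul_zero] at hexp
  exact sub_eq_zero.1 (norm_le_zero_iff.1 hexp)

theorem isMaxEigenvalue_parkingTrunc_iff (hm : 1 ≤ m) :
    IsMaxEigenvalue (parkingTrunc (m + 1)) l ↔
      l ∈ Set.Icc (6 / 5) 2 ∧ charFun parkingMatrix m l = 0 := by
  refine ⟨fun h => ?_, fun h => isMaxEigenvalue_parkingTrunc_of_charFun_eq_zero h.1 h.2⟩
  obtain ⟨l', hl', hzero⟩ := exists_charFun_parkingMatrix_eq_zero hm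
  rw [h.unique (isMaxEigenvalue_parkingTrunc_of_charFun_eq_zero hl' hzero)]
  exact ⟨hl', hzero⟩

theorem IsMaxEigenvalue.abs_sub_le (hm : 1 ≤ m) (hmm' : m ≤ m')
    (h : IsMaxEigenvalue (parkingTrunc (m + 1)) l)
    (h' : IsMaxEigenvalue (parkingTrunc (m' + 1)) l') :
    |l - l'| ≤ 6 * ∑ r ∈ Ico m m', |parkingMatrix (r + 2) 0| := by
  obtain ⟨hl, hzero⟩ := (isMaxEigenvalue_parkingTrunc_iff hm).1 h
  obtain ⟨hl', hzero'⟩ := (isMaxEigenvalue_parkingTrunc_iff (hm.trans hmm')).1 h'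
  have hexp := isBordered_parkingMatrix.norm_sub_le_eight_mul (hl.1.trans (Real.le_norm_self l))
    (hl'.1.trans (Real.le_norm_self l')) (abs_parkingMatrix_diag_sub_le hl') m'
  have htail := abs_charFun_parkingMatrix_sub_le hmm' hl.1
  rw [hzero', ← hzero] at hexp
  rw [Real.norm_eq_abs, Real.norm_eq_abs] at hexp
  have hcol : 0 ≤ ∑ r ∈ Ico m m', |parkingMatrix (r + 2) 0| :=
    Finset.sum_nonneg fun _ _ => abs_nonneg _
  linarith

end MaxEigenvalue

section Eigentriple

variable {c m n : ℕ} {l : ℝ}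

theorem padZero_of_lt (x : Fin n → ℝ) {i : ℕ} (hi : i < n) : padZero x i = x ⟨i, hi⟩ := dif_pos hi

theorem padZero_of_le (x : Fin n → ℝ) {i : ℕ} (hi : n ≤ i) : padZero x i = 0 := dif_neg hi.not_gt

theorem padZero_comp_val (x : Fin n → ℝ) : (fun i : Fin n => padZero x i) = x :=
  funext fun i => padZero_of_lt x i.isLt

theorem eq_zero_of_padZero_eq_zero {x : Fin n → ℝ} (h : padZero x = 0) : x = 0 := by
  rw [← padZero_comp_val x, h]
  rfl

theorem isRightEigenseq_padZero {A : ℕ → ℕ → ℝ} {v : Fin n → ℝ}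
    (h : Matrix.mulVec (truncation A n) v = l • v) : IsRightEigenseq A n l (padZero v) where
  mul_eq := mulVec_truncation_eq_smul_iff.1 (by rwa [padZero_comp_val])
  eq_zero_of_le _ hi := padZero_of_le v hi

theorem IsRightEigenseq.apply_eq_pow_mul {u : ℕ → ℝ}
    (hu : IsRightEigenseq parkingMatrix (m + 2) l u) (hc : c = 0 ∨ c = 1) :
    u c = (1 / 2 - l) ^ c * u 0 := by
  rcases hc with rfl | rfl
  · rw [pow_zero, one_mul]
  · rw [pow_one, hu.apply_one isBordered_parkingMatrix, parkingMatrix_zero_zero]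

theorem IsBordered.padZero_eq_mul_leftEigenseq {A : ℕ → ℕ → ℝ} {q B s : ℝ}
    (hA : IsBordered A q B s) (hl : q < ‖l‖) {w : Fin (m + 2) → ℝ}
    (h : Matrix.vecMul w (truncation A (m + 2)) = l • w) {i : ℕ} (hi : i < m + 2) :
    padZero w i = padZero w 1 * leftEigenseq A l i :=
  ((hA.vecMul_eq_iff hl).1
    (vecMul_truncation_eq_smul_iff.1 (by rwa [padZero_comp_val]))).1 i hi

theorem leftEigenseq_parkingMatrix_ne_zero (hc : c = 0 ∨ c = 1) (hl : 6 / 5 ≤ l) :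
    leftEigenseq parkingMatrix l c ≠ 0 := by
  rcases hc with rfl | rfl
  · rw [leftEigenseq, parkingMatrix_one_one]
    linarith [Real.log_two_lt_d9]
  · rw [leftEigenseq]
    exact one_ne_zero

theorem existsUnique_mem_apply_eq_one {K V : Type*} [Field K] [AddCommGroup V] [Module K V]
    {p : Submodule K V} (hp : p ≠ ⊥) {φ : V →ₗ[K] K} (hφ : ∀ x ∈ p, φ x = 0 → x = 0) :
    ∃! x, x ∈ p ∧ φ x = 1 := by
  obtain ⟨x, hx, hx₀⟩ := p.ne_bot_iff.1 hp
  have hnorm : φ ((φ x)⁻¹ • x) = 1 := by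
    rw [map_smul, smul_eq_mul, inv_mul_cancel₀ (mt (hφ x hx) hx₀)]
  refine ⟨(φ x)⁻¹ • x, ⟨p.smul_mem _ hx, hnorm⟩, fun y ⟨hy, hy₁⟩ => sub_eq_zero.1 ?_⟩
  exact hφ _ (p.sub_mem hy (p.smul_mem _ hx)) (by rw [map_sub, hy₁, hnorm, sub_self])

theorem existsUnique_mulVec_truncation (hc : c = 0 ∨ c = 1) (hl : 6 / 5 ≤ l)
    (hzero : charFun parkingMatrix m l = 0) :
    ∃! v, Matrix.mulVec (truncation parkingMatrix (m + 2)) v = l • v ∧ padZero v c = 1 := by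
  have hnorm : 1 / 2 < ‖l‖ := by linarith [Real.le_norm_self l]
  have hker (v : Fin (m + 2) → ℝ) (hv : Matrix.mulVec (truncation parkingMatrix (m + 2)) v = l • v)
      (hvc : padZero v c = 0) : v = 0 := by
    have hu := isRightEigenseq_padZero hv
    rw [hu.apply_eq_pow_mul hc] at hvc
    exact eq_zero_of_padZero_eq_zero (hu.eq_zero isBordered_parkingMatrix hnorm
      ((mul_eq_zero.1 hvc).resolve_left (pow_ne_zero _ (by linarith))))
  have hc' : c < m + 2 := by omega
  have heig := (isBordered_parkingMatrix.hasEigenvalue_truncation_iff hnorm).2 hzero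
  simpa only [Module.End.mem_eigenspace_iff, Matrix.toLin'_apply, LinearMap.proj_apply,
    ← padZero_of_lt _ hc'] using existsUnique_mem_apply_eq_one heig
      (φ := LinearMap.proj ⟨c, hc'⟩) fun v hv hvc =>
        hker v (Module.End.mem_eigenspace_iff.1 hv) (by rwa [padZero_of_lt v hc'])

theorem existsUnique_vecMul_truncation (hc : c = 0 ∨ c = 1) (hl : 6 / 5 ≤ l)
    (hzero : charFun parkingMatrix m l = 0) :
    ∃! w, Matrix.vecMul w (truncation parkingMatrix (m + 2)) = l • w ∧ padZero w c = 1 := by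
  have hnorm : 1 / 2 < ‖l‖ := by linarith [Real.le_norm_self l]
  have hc' : c < m + 2 := by omega
  have hker (w : Fin (m + 2) → ℝ) (hw : Matrix.vecMul w (truncation parkingMatrix (m + 2)) = l • w)
      (hwc : padZero w c = 0) : w = 0 := by
    have hwi {i : ℕ} (hi : i < m + 2) :=
      isBordered_parkingMatrix.padZero_eq_mul_leftEigenseq hnorm hw hi
    rw [hwi hc'] at hwc
    have hone := (mul_eq_zero.1 hwc).resolve_right (leftEigenseq_parkingMatrix_ne_zero hc hl)
    refine funext fun i => ?_
    rw [← padZero_of_lt w i.isLt, hwi i.isLt, hone, zero_mul, Pi.zero_apply]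
  have heig := hasEigenvalue_toLin'_transpose_iff.2
    ((isBordered_parkingMatrix.hasEigenvalue_truncation_iff hnorm).2 hzero)
  simpa only [Module.End.mem_eigenspace_iff, Matrix.toLin'_apply, Matrix.mulVec_transpose,
    LinearMap.proj_apply, ← padZero_of_lt _ hc'] using existsUnique_mem_apply_eq_one heig
      (φ := LinearMap.proj ⟨c, hc'⟩) fun w hw hwc =>
        hker w (by simpa only [Module.End.mem_eigenspace_iff, Matrix.toLin'_apply,
          Matrix.mulVec_transpose] using hw) (by rwa [padZero_of_lt w hc'])

theorem existsUnique_isMaxEigentriple (hc : c = 0 ∨ c = 1) (hm : 1 ≤ m) :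
    ∃! t : ℝ × (Fin (m + 2) → ℝ) × (Fin (m + 2) → ℝ),
      IsMaxEigentriple (m + 1) c t.1 t.2.1 t.2.2 := by
  obtain ⟨l, hl, hzero⟩ := exists_charFun_parkingMatrix_eq_zero hm
  have hmax := isMaxEigenvalue_parkingTrunc_of_charFun_eq_zero hl hzero
  obtain ⟨v, ⟨hv, hvc⟩, hvuniq⟩ := existsUnique_mulVec_truncation hc hl.1 hzero
  obtain ⟨w, ⟨hw, hwc⟩, hwuniq⟩ := existsUnique_vecMul_truncation hc hl.1 hzero
  refine ⟨(l, v, w), ⟨hmax, hv, hw, hvc, hwc⟩, fun ⟨l', v', w'⟩ h => ?_⟩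
  obtain rfl : l' = l := h.isMax.unique hmax
  rw [hvuniq v' ⟨h.right, h.right_norm⟩, hwuniq w' ⟨h.left, h.left_norm⟩]

end Eigentriple

section SequenceSpaces

variable {ρ σ : ℝ} {x y : ℕ → ℝ} {n : ℕ}

theorem memEllOne_of_eq_zero_of_le (hx : ∀ i, n ≤ i → x i = 0) : MemEllOne ρ x :=
  summable_of_ne_finset_zero (s := range n) fun i hi => by
    rw [hx i (not_lt.1 (mt Finset.mem_range.2 hi)), abs_zero, mul_zero]

theorem ellOneNorm_eq_sum_range (hx : ∀ i, n ≤ i → x i = 0) :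
    ellOneNorm ρ x = ∑ i ∈ range n, ρ ^ i * |x i| :=
  tsum_eq_sum fun i hi => by
    rw [hx i (not_lt.1 (mt Finset.mem_range.2 hi)), abs_zero, mul_zero]

theorem MemEllOne.mono (hx : MemEllOne σ x) (hρ : 0 ≤ ρ) (h : ρ ≤ σ) : MemEllOne ρ x :=
  Summable.of_nonneg_of_le (fun _ => by positivity) (fun i => by gcongr) hx

theorem MemEllOne.ellOneNorm_mono (hx : MemEllOne σ x) (hρ : 0 ≤ ρ) (h : ρ ≤ σ) :
    ellOneNorm ρ x ≤ ellOneNorm σ x :=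
  (hx.mono hρ h).tsum_le_tsum (fun i => by gcongr) hx

theorem MemEllOne.sub (hx : MemEllOne ρ x) (hy : MemEllOne ρ y) (hρ : 0 ≤ ρ) :
    MemEllOne ρ fun i => x i - y i := by
  refine Summable.of_nonneg_of_le (fun _ => by positivity) (fun i => ?_) (Summable.add hx hy)
  rw [← mul_add]
  exact mul_le_mul_of_nonneg_left (abs_sub _ _) (by positivity)

theorem cauchySeq_of_eventually_dist_le {X : Type*} [PseudoMetricSpace X] {f : ℕ → X} {b : ℕ → ℝ}
    (hb : Tendsto b atTop (𝓝 0)) (h : ∀ᶠ n in atTop, ∀ m ≥ n, dist (f n) (f m) ≤ b n) :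
    CauchySeq f := by
  obtain ⟨N, hN⟩ := eventually_atTop.1 h
  exact (cauchySeq_shift N).1 <| cauchySeq_of_le_tendsto_0' (fun n => b (n + N))
    (fun n m hnm => hN _ (Nat.le_add_left N n) _ (Nat.add_le_add_right hnm N))
    ((tendsto_add_atTop_iff_nat N).2 hb)

theorem exists_tendsto_ellOneNorm_mul_sub (hρ : 0 < ρ) {u : ℕ → ℕ → ℝ}
    (hu : ∀ n, MemEllOne ρ (u n)) {b : ℕ → ℝ} (hb : Tendsto b atTop (𝓝 0))
    (h : ∀ᶠ n in atTop, ∀ m ≥ n, ellOneNorm ρ (fun i => u m i - u n i) ≤ b n)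
    {a : ℕ → ℝ} {α : ℝ} (ha : Tendsto a atTop (𝓝 α)) :
    ∃ x, MemEllOne ρ x ∧
      Tendsto (fun n => ellOneNorm ρ fun i => a n * u n i - x i) atTop (𝓝 0) := by
  have hpow (i : ℕ) : |ρ ^ i| = ρ ^ i := abs_of_pos (pow_pos hρ i)
  have hnorm (f : lp (fun _ : ℕ => ℝ) 1) : ‖f‖ = ∑' i, |f i| := by
    simp only [lp.norm_eq_tsum_rpow (p := 1) (by norm_num), ENNReal.toReal_one, Real.rpow_one,
      one_div_one, Real.norm_eq_abs]
  have hmem (n : ℕ) : Memℓp (fun i => ρ ^ i * u n i) 1 := memℓp_gen <| by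
    simpa only [ENNReal.toReal_one, Real.rpow_one, Real.norm_eq_abs, abs_mul, hpow, MemEllOne]
      using hu n
  let f : ℕ → lp (fun _ : ℕ => ℝ) 1 := fun n => ⟨_, hmem n⟩
  have hcauchy : CauchySeq f := by
    refine cauchySeq_of_eventually_dist_le hb (h.mono fun n hn m hnm => ?_)
    rw [dist_comm, dist_eq_norm, hnorm]
    refine (tsum_congr fun i => ?_).trans_le (hn m hnm)
    change |ρ ^ i * u m i - ρ ^ i * u n i| = _
    rw [← mul_sub, abs_mul, hpow]
  obtain ⟨g, hg⟩ := cauchySeq_tendsto_of_complete hcauchy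
  refine ⟨fun i => (α • g) i / ρ ^ i, ?_, ?_⟩
  · refine ((lp.memℓp (α • g)).summable (by norm_num)).congr fun i => ?_
    rw [abs_div, hpow, mul_div_cancel₀ _ (pow_pos hρ i).ne', ENNReal.toReal_one, Real.rpow_one,
      Real.norm_eq_abs]
  · refine (tendsto_iff_norm_sub_tendsto_zero.1 (ha.smul hg)).congr fun n => ?_
    rw [hnorm]
    refine tsum_congr fun i => ?_
    change |a n * (ρ ^ i * u n i) - (α • g) i| = _
    rw [← hpow, ← abs_mul, hpow, mul_sub, mul_div_cancel₀ _ (pow_pos hρ i).ne', mul_left_comm]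

theorem tendsto_padEllInfty {f : ℕ → ℝ} (hf : Tendsto f atTop (𝓝 0))
    {z : (n : ℕ) → Fin (n + 1) → ℝ} {e : ℕ → ℝ} (he : Tendsto e atTop (𝓝 0))
    (h : ∀ᶠ n in atTop, ∀ i, |z n i - f i| ≤ e n) :
    Tendsto (fun n => padEllInfty (z n)) atTop
      (𝓝 ⟨f, memℓp_infty hf.norm.bddAbove_range⟩) := by
  rw [Metric.tendsto_nhds]
  intro ε hε
  have htail := hf.abs.eventually_lt_const (abs_zero.trans_lt (half_pos hε))
  filter_upwards [h, he.eventually_lt_const (half_pos hε), eventually_forall_ge_atTop.2 htail]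
    with n hn hen hfn
  rw [dist_eq_norm]
  refine (lp.norm_le_of_forall_le (half_pos hε).le fun i => ?_).trans_lt (half_lt_self hε)
  change |padZero (z n) i - f i| ≤ ε / 2
  rcases lt_or_ge i (n + 1) with hi | hi
  · rw [padZero_of_lt _ hi]
    exact (hn ⟨i, hi⟩).trans hen.le
  · rw [padZero_of_le _ hi, zero_sub, abs_neg]
    exact (hfn i (Nat.le_of_succ_le hi)).le

end SequenceSpaces

section Convergence

variable {c m m' : ℕ} {l l' : ℝ}

/-- The tail, from index `m` on, of the series by which the column `0` of the matrix belongs to the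
extremal space `ℓ¹_3`. -/
def colTail (m : ℕ) : ℝ := ∑' r, 3 ^ (r + m) * |parkingMatrix (r + m + 2) 0|

theorem tendsto_colTail : Tendsto colTail atTop (𝓝 0) :=
  tendsto_sum_nat_add fun r => 3 ^ r * |parkingMatrix (r + 2) 0|

theorem sum_Ico_pow_mul_abs_le_colTail (m m' : ℕ) :
    ∑ r ∈ Ico m m', 3 ^ r * |parkingMatrix (r + 2) 0| ≤ colTail m := by
  rw [Finset.sum_Ico_eq_sum_range]
  simp only [add_comm m]
  exact ((summable_nat_add_iff m).2 summable_pow_mul_abs_parkingMatrix_add_two_zero).sum_le_tsum _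
    fun _ _ => by positivity

theorem colTail_nonneg (m : ℕ) : 0 ≤ colTail m := tsum_nonneg fun _ => by positivity

theorem IsMaxEigenvalue.abs_sub_le_colTail (hm : 1 ≤ m) (hmm' : m ≤ m')
    (h : IsMaxEigenvalue (parkingTrunc (m + 1)) l)
    (h' : IsMaxEigenvalue (parkingTrunc (m' + 1)) l') : |l - l'| ≤ 6 * colTail m := by
  refine (h.abs_sub_le hm hmm' h').trans (mul_le_mul_of_nonneg_left ?_ (by norm_num))
  refine (Finset.sum_le_sum fun r _ => ?_).trans (sum_Ico_pow_mul_abs_le_colTail m m')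
  exact le_mul_of_one_le_left (abs_nonneg _) (one_le_pow₀ (by norm_num))

theorem exists_tendsto_isMaxEigenvalue {lam : ℕ → ℝ}
    (h : ∀ᶠ n in atTop, IsMaxEigenvalue (parkingTrunc n) (lam n)) :
    ∃ L, Tendsto lam atTop (𝓝 L) := by
  refine cauchySeq_tendsto_of_complete (cauchySeq_of_eventually_dist_le
    (b := fun n => 6 * colTail (n - 1)) ?_ ?_)
  · simpa only [mul_zero, Function.comp_apply] using
      (tendsto_colTail.comp (tendsto_sub_atTop_nat 1)).const_mul 6
  · filter_upwards [eventually_forall_ge_atTop.2 h, eventually_ge_atTop 2] with n hn hn₂ m hnm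
    have hmax := hn m hnm
    obtain ⟨n, rfl⟩ := Nat.exists_eq_add_of_le' (one_le_two.trans hn₂)
    obtain ⟨m, rfl⟩ := Nat.exists_eq_add_of_le' ((one_le_two.trans hn₂).trans hnm)
    exact (hn _ le_rfl).abs_sub_le_colTail (by omega) (by omega) hmax

theorem IsRightEigenseq.ellOneNorm_sub_le {u u' : ℕ → ℝ} (hmm' : m ≤ m')
    (hu : IsRightEigenseq parkingMatrix (m + 2) l u)
    (hu' : IsRightEigenseq parkingMatrix (m' + 2) l' u') (h₀ : u 0 = 1) (h₀' : u' 0 = 1)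
    (hl : 6 / 5 ≤ l) (hl' : 6 / 5 ≤ l') (hll' : |l - l'| ≤ 6 * colTail m) :
    ellOneNorm 3 (fun i => u' i - u i) ≤ (31 + 111 * colTail 0) * colTail m := by
  set S := ∑ r ∈ range m, 3 ^ r * ‖u (r + 2)‖
  set D := ∑ r ∈ range m', 3 ^ r * ‖u' (r + 2) - u (r + 2)‖ with hD
  have hS₀ : 0 ≤ S := Finset.sum_nonneg fun _ _ => by positivity
  have hD₀ : 0 ≤ D := Finset.sum_nonneg fun _ _ => by positivity
  have hone : |u' 1 - u 1| = |l - l'| := by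
    rw [hu.apply_one isBordered_parkingMatrix, hu'.apply_one isBordered_parkingMatrix, h₀, h₀',
      mul_one, mul_one, sub_sub_sub_cancel_left]
  have hnorm : ellOneNorm 3 (fun i => u' i - u i) = 3 * |l - l'| + 9 * D := by
    rw [ellOneNorm_eq_sum_range (n := m' + 2) fun i hi => by
      rw [hu'.eq_zero_of_le i hi, hu.eq_zero_of_le i (by omega), sub_zero],
      sum_range_add_two, hone, h₀, h₀', sub_self, abs_zero, mul_zero, zero_add, pow_one, hD,
      Finset.mul_sum]
    simp only [pow_add, Real.norm_eq_abs]
    ring_nf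
  have hSle : 7 / 10 * S ≤ colTail 0 := by
    have hsum := hu.sum_pow_mul_norm_le isBordered_parkingMatrix (ρ := 3) (by norm_num)
    have htail := sum_Ico_pow_mul_abs_le_colTail 0 m
    rw [h₀, norm_one, mul_one, Real.norm_of_nonneg (by linarith)] at hsum
    rw [← Finset.range_eq_Ico] at htail
    exact (mul_le_mul_of_nonneg_right (by linarith) hS₀).trans (hsum.trans htail)
  have hDle : 7 / 10 * D ≤ 6 * colTail m * (10 / 7 * colTail 0) + colTail m := by
    have hsum := hu.sum_pow_mul_norm_sub_le hu' isBordered_parkingMatrix hmm' (h₀'.trans h₀.symm)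
      (ρ := 3) (by norm_num)
    rw [h₀, norm_one, mul_one, Real.norm_of_nonneg (by linarith)] at hsum
    refine (mul_le_mul_of_nonneg_right (by linarith) hD₀).trans (hsum.trans (add_le_add
      (mul_le_mul hll' (by linarith) hS₀ ?_) (sum_Ico_pow_mul_abs_le_colTail m m')))
    exact mul_nonneg (by norm_num) (colTail_nonneg m)
  rw [hnorm]
  linarith [mul_nonneg (colTail_nonneg 0) (colTail_nonneg m), colTail_nonneg m]

theorem IsMaxEigentriple.pow_mul_padZero_right_zero {v w : Fin (m + 2) → ℝ}
    (h : IsMaxEigentriple (m + 1) c l v w) (hc : c = 0 ∨ c = 1) :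
    (1 / 2 - l) ^ c * padZero v 0 = 1 :=
  ((isRightEigenseq_padZero h.right).apply_eq_pow_mul hc).symm.trans h.right_norm

theorem IsMaxEigentriple.ellOneNorm_right_sub_le {v w : Fin (m + 2) → ℝ}
    {v' w' : Fin (m' + 2) → ℝ} (h : IsMaxEigentriple (m + 1) c l v w)
    (h' : IsMaxEigentriple (m' + 1) c l' v' w') (hc : c = 0 ∨ c = 1) (hm : 1 ≤ m) (hmm' : m ≤ m')
    (hl : 6 / 5 ≤ l) (hl' : 6 / 5 ≤ l') :
    ellOneNorm 3 (fun i => (1 / 2 - l') ^ c * padZero v' i - (1 / 2 - l) ^ c * padZero v i) ≤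
      (31 + 111 * colTail 0) * colTail m :=
  IsRightEigenseq.ellOneNorm_sub_le hmm' ((isRightEigenseq_padZero h.right).smul _)
    ((isRightEigenseq_padZero h'.right).smul _) (h.pow_mul_padZero_right_zero hc)
    (h'.pow_mul_padZero_right_zero hc) hl hl' (h.isMax.abs_sub_le_colTail hm hmm' h'.isMax)

theorem IsMaxEigentriple.padZero_left {v w : Fin (m + 2) → ℝ}
    (h : IsMaxEigentriple (m + 1) c l v w) (hc : c = 0 ∨ c = 1) (hl : 6 / 5 ≤ l) {i : ℕ}
    (hi : i < m + 2) :
    padZero w i = (leftEigenseq parkingMatrix l c)⁻¹ * leftEigenseq parkingMatrix l i := by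
  have hw {i : ℕ} (hi : i < m + 2) := isBordered_parkingMatrix.padZero_eq_mul_leftEigenseq
    (by linarith [Real.le_norm_self l]) h.left hi
  rw [hw hi, eq_inv_of_mul_eq_one_left ((hw (by omega)).symm.trans h.left_norm)]

theorem eventually_mem_Icc_of_isMaxEigenvalue {lam : ℕ → ℝ}
    (h : ∀ᶠ n in atTop, IsMaxEigenvalue (parkingTrunc n) (lam n)) :
    ∀ᶠ n in atTop, lam n ∈ Set.Icc (6 / 5) 2 := by
  filter_upwards [h, eventually_ge_atTop 2] with n hn hn₂
  obtain ⟨n, rfl⟩ := Nat.exists_eq_add_of_le' (one_le_two.trans hn₂)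
  exact ((isMaxEigenvalue_parkingTrunc_iff (by omega)).1 hn).1

variable {lam : ℕ → ℝ} {v w : (n : ℕ) → Fin (n + 1) → ℝ} {L : ℝ}

theorem exists_tendsto_ellOneNorm_right (hc : c = 0 ∨ c = 1)
    (h : ∀ᶠ n in atTop, IsMaxEigentriple n c (lam n) (v n) (w n)) (hL : Tendsto lam atTop (𝓝 L))
    (hL' : L ∈ Set.Icc (6 / 5) 2) :
    ∃ x, MemEllOne 3 x ∧
      Tendsto (fun n => ellOneNorm 3 fun i => padZero (v n) i - x i) atTop (𝓝 0) := by
  have hIcc := eventually_mem_Icc_of_isMaxEigenvalue (h.mono fun n hn => hn.isMax)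
  have hmem (n : ℕ) : MemEllOne 3 fun i => (1 / 2 - lam n) ^ c * padZero (v n) i :=
    memEllOne_of_eq_zero_of_le fun i hi => by rw [padZero_of_le _ hi, mul_zero]
  have hb : Tendsto (fun n => (31 + 111 * colTail 0) * colTail (n - 1)) atTop (𝓝 0) := by
    simpa only [mul_zero, Function.comp_apply] using
      (tendsto_colTail.comp (tendsto_sub_atTop_nat 1)).const_mul (31 + 111 * colTail 0)
  have hcauchy : ∀ᶠ n in atTop, ∀ m ≥ n,
      ellOneNorm 3 (fun i =>
        (1 / 2 - lam m) ^ c * padZero (v m) i - (1 / 2 - lam n) ^ c * padZero (v n) i) ≤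
      (31 + 111 * colTail 0) * colTail (n - 1) := by
    filter_upwards [eventually_forall_ge_atTop.2 (h.and hIcc), eventually_ge_atTop 2]
      with n hn hn₂ m hnm
    obtain ⟨hm, hmIcc⟩ := hn m hnm
    obtain ⟨hn, hnIcc⟩ := hn n le_rfl
    obtain ⟨n, rfl⟩ := Nat.exists_eq_add_of_le' (one_le_two.trans hn₂)
    obtain ⟨m, rfl⟩ := Nat.exists_eq_add_of_le' ((one_le_two.trans hn₂).trans hnm)
    exact hn.ellOneNorm_right_sub_le hm hc (by omega) (by omega) hnIcc.1 hmIcc.1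
  have ha : Tendsto (fun n => ((1 / 2 - lam n) ^ c)⁻¹) atTop (𝓝 ((1 / 2 - L) ^ c)⁻¹) :=
    ((hL.const_sub _).pow c).inv₀ (pow_ne_zero _ (by linarith [hL'.1]))
  obtain ⟨x, hx, hlim⟩ := exists_tendsto_ellOneNorm_mul_sub (by norm_num) hmem hb hcauchy ha
  refine ⟨x, hx, hlim.congr' (hIcc.mono fun n hn => ?_)⟩
  simp only [inv_mul_cancel_left₀ (pow_ne_zero c (by linarith [hn.1] : 1 / 2 - lam n ≠ 0))]

theorem abs_leftEigenseq_parkingMatrix_sub_le (hl : 6 / 5 ≤ l) (hl' : 6 / 5 ≤ l') (i : ℕ) :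
    |leftEigenseq parkingMatrix l i - leftEigenseq parkingMatrix l' i| ≤ 3 * |l - l'| := by
  have hnorm := Real.le_norm_self l
  have hnorm' := Real.le_norm_self l'
  refine (isBordered_parkingMatrix.norm_leftEigenseq_sub_le (by linarith) (by linarith) i).trans ?_
  rw [mul_comm, Real.norm_eq_abs (l - l')]
  refine mul_le_mul_of_nonneg_right ?_ (abs_nonneg _)
  rw [← le_sub_iff_add_le', div_le_iff₀ (mul_pos (by linarith) (by linarith))]
  nlinarith

theorem exists_tendsto_padEllInfty_left (hc : c = 0 ∨ c = 1)
    (h : ∀ᶠ n in atTop, IsMaxEigentriple n c (lam n) (v n) (w n)) (hL : Tendsto lam atTop (𝓝 L))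
    (hL' : L ∈ Set.Icc (6 / 5) 2) :
    ∃ wLim, Tendsto (fun n => padEllInfty (w n)) atTop (𝓝 wLim) := by
  have hIcc := eventually_mem_Icc_of_isMaxEigenvalue (h.mono fun n hn => hn.isMax)
  have hle : ∀ᶠ n in atTop, ∀ i, |leftEigenseq parkingMatrix (lam n) i -
      leftEigenseq parkingMatrix L i| ≤ 3 * |lam n - L| :=
    hIcc.mono fun n hn => abs_leftEigenseq_parkingMatrix_sub_le hn.1 hL'.1
  have he : Tendsto (fun n => 3 * |lam n - L|) atTop (𝓝 0) := by
    simpa only [sub_self, abs_zero, mul_zero] using ((hL.sub_const L).abs).const_mul 3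
  have hvanish := isBordered_parkingMatrix.tendsto_leftEigenseq (l := L)
    (by linarith [hL'.1, Real.le_norm_self L]) fun i => tendsto_parkingMatrix_row i
  have hlim := tendsto_padEllInfty hvanish he
    (z := fun n i => leftEigenseq parkingMatrix (lam n) i) (hle.mono fun n hn i => hn i)
  have hscale : Tendsto (fun n => leftEigenseq parkingMatrix (lam n) c) atTop
      (𝓝 (leftEigenseq parkingMatrix L c)) :=
    tendsto_iff_norm_sub_tendsto_zero.2
      (squeeze_zero' (.of_forall fun _ => norm_nonneg _) (hle.mono fun n hn => hn c) he)
  refine ⟨_, ((hscale.inv₀ (leftEigenseq_parkingMatrix_ne_zero hc hL'.1)).smul hlim).congr' ?_⟩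
  filter_upwards [h, hIcc, eventually_ge_atTop 1] with n hn hnIcc hn₁
  obtain ⟨n, rfl⟩ := Nat.exists_eq_add_of_le' hn₁
  ext i
  change (leftEigenseq parkingMatrix (lam (n + 1)) c)⁻¹ *
    padZero (fun j : Fin (n + 2) => leftEigenseq parkingMatrix (lam (n + 1)) j) i =
      padZero (w (n + 1)) i
  rcases lt_or_ge i (n + 2) with hi | hi
  · rw [hn.padZero_left hc hnIcc.1 hi, padZero_of_lt _ hi]
  · rw [padZero_of_le _ hi, padZero_of_le _ hi, mul_zero]

end Convergence

theorem mainTheorem6_general (c : ℕ) (hc : c = 0 ∨ c = 1) :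
    (∀ n : ℕ, 2 ≤ n →
      ∃! t : ℝ × (Fin (n + 1) → ℝ) × (Fin (n + 1) → ℝ),
        IsMaxEigentriple n c t.1 t.2.1 t.2.2) ∧
    ∀ (lam : ℕ → ℝ) (v w : (n : ℕ) → Fin (n + 1) → ℝ),
      (∀ᶠ n in atTop, IsMaxEigentriple n c (lam n) (v n) (w n)) →
        (∃ lamLim : ℝ, Tendsto lam atTop (𝓝 lamLim)) ∧
        (∃ vLim : ℕ → ℝ, ∀ ρ : ℝ, 0 ≤ ρ → ρ ≤ 3 →
          MemEllOne ρ vLim ∧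
          Tendsto (fun n => ellOneNorm ρ (fun i => padZero (v n) i - vLim i)) atTop (𝓝 0)) ∧
        (∃ wLim : lp (fun _ : ℕ => ℝ) ∞,
          Tendsto (fun n => padEllInfty (w n)) atTop (𝓝 wLim)) := by
  refine ⟨fun n hn => ?_, fun lam v w h => ?_⟩
  · obtain ⟨m, rfl⟩ := Nat.exists_eq_add_of_le' (one_le_two.trans hn)
    exact existsUnique_isMaxEigentriple hc (by omega)
  have hmax := h.mono fun n hn => hn.isMax
  obtain ⟨L, hL⟩ := exists_tendsto_isMaxEigenvalue hmax
  have hL' := isClosed_Icc.mem_of_tendsto hL (eventually_mem_Icc_of_isMaxEigenvalue hmax)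
  obtain ⟨x, hx, hlim⟩ := exists_tendsto_ellOneNorm_right hc h hL hL'
  refine ⟨⟨L, hL⟩, ⟨x, fun ρ hρ hρ₃ => ⟨hx.mono hρ hρ₃, ?_⟩⟩,
    exists_tendsto_padEllInfty_left hc h hL hL'⟩
  have hsub (n : ℕ) : MemEllOne 3 fun i => padZero (v n) i - x i :=
    (memEllOne_of_eq_zero_of_le fun _ hi => padZero_of_le (v n) hi).sub hx (by norm_num)
  exact squeeze_zero (fun n => tsum_nonneg fun i => by positivity)
    (fun n => (hsub n).ellOneNorm_mono hρ hρ₃) hlim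

end

theorem mainTheorem6 (c : ℕ) (hc : c = 0 ∨ c = 1) :
    (∀ n : ℕ, 7 ≤ n →
      ∃! t : ℝ × (Fin (n + 1) → ℝ) × (Fin (n + 1) → ℝ),
        IsMaxEigentriple n c t.1 t.2.1 t.2.2) ∧
    ∀ (lam : ℕ → ℝ) (v w : (n : ℕ) → Fin (n + 1) → ℝ),
      (∀ᶠ n in atTop, IsMaxEigentriple n c (lam n) (v n) (w n)) →
        (∃ lamLim : ℝ, Tendsto lam atTop (𝓝 lamLim)) ∧
        (∃ vLim : ℕ → ℝ, ∀ ρ : ℝ, 1 ≤ ρ → ρ ≤ 3 →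
          MemEllOne ρ vLim ∧
          Tendsto (fun n => ellOneNorm ρ (fun i => padZero (v n) i - vLim i)) atTop (𝓝 0)) ∧
        (∃ wLim : lp (fun _ : ℕ => ℝ) ∞,
          Tendsto (fun n => padEllInfty (w n)) atTop (𝓝 wLim)) :=
  ⟨fun n hn => (mainTheorem6_general c hc).1 n (by omega), fun lam v w h => by
    obtain ⟨hlam, ⟨x, hx⟩, hw⟩ := (mainTheorem6_general c hc).2 lam v w h
    exact ⟨hlam, ⟨x, fun ρ hρ => hx ρ (zero_le_one.trans hρ)⟩, hw⟩⟩
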